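/- Let $E : y^2+xy=x^3+x^2-2x$ and $E' : y^2+xy=x^3+x^2+8x+10$ over $\mathbb{Q}$, let $P=(2,2)\in E(\mathbb{Q})$, and let $\phi:E\to E'$ be the $2$-isogeny $\phi(x,y)=\left(\frac{x^2-2}{x},\frac{x^2y+2x+2y}{x^2}\right)$ with kernel $\{0,(0,0)\}$. Fix a compatible system of bases $(A_k,B_k)$ of $E[2^k]\subset E(\mathbb{C})$ and $(C_k,D_k)$ of $E'[2^k]\subset E'(\mathbb{C})$ over $\mathbb{Z}/2^k\mathbb{Z}$ such that $2A_{k+1}=A_k$, $2B_{k+1}=B_k$, $2C_{k+1}=C_k$, $2D_{k+1}=D_k$, $\phi(A_k)=C_k$ and $\phi(B_k)=2D_k$ for all $k$. Let $K_k\subset\mathbb{C}$ be the field obtained by adjoining to $\mathbb{Q}$ the coordinates of all points $\beta\in E(\mathbb{C})$ with $2^k\beta=P$, and fix one such point $\beta_k$. For $\sigma\in\mathrm{Gal}(K_k/\mathbb{Q})$ write $$\sigma(\beta_k)=\beta_k+eA_k+fB_k,\qquad \sigma(A_k)=aA_k+bB_k,\qquad \sigma(B_k)=cA_k+dB_k$$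 and set $\rho_{E,2^k}(\sigma)=((e,f),M)$, where $e,f\in\mathbb{Z}/2^k\mathbb{Z}$ and $M=\begin{bmatrix}a&b\\c&d\end{bmatrix}\in \mathrm{GL}_2(\mathbb{Z}/2^k\mathbb{Z})$. Theorem. Let $k\ge 3$, let $\sigma\in\mathrm{Gal}(K_k/\mathbb{Q})$, and suppose $\rho_{E,2^k}(\sigma)=((e,f),M)$. Then $e\equiv 0\pmod 2$ if and only if $\det M\equiv 1$ or $7\pmod 8$. Moreover $\sqrt2\in K_k$, and each of these two conditions holds if and only if $\sigma(\sqrt2)=\sqrt2$. -/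

import Mathlib

namespace SomosFive

open scoped Classical WeierstrassCurve.Affine

/-- The elliptic curve `E : y² + xy = x³ + x² - 2x` over `ℚ`. -/
noncomputable def E : WeierstrassCurve.Affine ℚ := ⟨1, 1, 0, -2, 0⟩

/-- The elliptic curve `E' : y² + xy = x³ + x² + 8x + 10` over `ℚ`. -/
noncomputable def E' : WeierstrassCurve.Affine ℚ := ⟨1, 1, 0, 8, 10⟩

/-- The group `E(ℂ)`. -/
abbrev EC : Type := (E⁄ℂ).Point

/-- The group `E'(ℂ)`. -/
abbrev EC' : Type := (E'⁄ℂ).Point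

theorem E_equation_iff (x y : ℂ) :
    (E⁄ℂ).Equation x y ↔ y ^ 2 + x * y = x ^ 3 + x ^ 2 - 2 * x := by
  rw [WeierstrassCurve.Affine.equation_iff]
  simp [E, WeierstrassCurve.Affine.baseChange]
  ring_nf

theorem E'_equation_iff (x y : ℂ) :
    (E'⁄ℂ).Equation x y ↔ y ^ 2 + x * y = x ^ 3 + x ^ 2 + 8 * x + 10 := by
  rw [WeierstrassCurve.Affine.equation_iff]
  simp [E', WeierstrassCurve.Affine.baseChange]

theorem E_nonsingular {x y : ℂ} (h : (E⁄ℂ).Equation x y) : (E⁄ℂ).Nonsingular x y := by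
  refine (WeierstrassCurve.Affine.equation_iff_nonsingular_of_Δ_ne_zero ?_).mp h
  simp [E, WeierstrassCurve.Affine.baseChange, WeierstrassCurve.Δ,
    WeierstrassCurve.b₂, WeierstrassCurve.b₄, WeierstrassCurve.b₆, WeierstrassCurve.b₈]
  norm_num

theorem E'_nonsingular {x y : ℂ} (h : (E'⁄ℂ).Equation x y) : (E'⁄ℂ).Nonsingular x y := by
  refine (WeierstrassCurve.Affine.equation_iff_nonsingular_of_Δ_ne_zero ?_).mp h
  simp [E', WeierstrassCurve.Affine.baseChange, WeierstrassCurve.Δ,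
    WeierstrassCurve.b₂, WeierstrassCurve.b₄, WeierstrassCurve.b₆, WeierstrassCurve.b₈]
  norm_num

/-- The point `P = (2, 2)` of `E(ℂ)`. -/
noncomputable def P : EC := .some 2 2 (E_nonsingular ((E_equation_iff 2 2).mpr (by norm_num)))

theorem isogeny_equation {x y : ℂ} (h : (E⁄ℂ).Nonsingular x y) (hx : x ≠ 0) :
    (E'⁄ℂ).Equation ((x ^ 2 - 2) / x) ((x ^ 2 * y + 2 * x + 2 * y) / x ^ 2) := by
  have h1 := (E_equation_iff x y).mp h.1
  rw [E'_equation_iff]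
  field_simp
  linear_combination (x ^ 2 + 2) ^ 2 * h1

/-- The `2`-isogeny `φ : E → E'`, `φ(x, y) = ((x² - 2) / x, (x² y + 2 x + 2 y) / x²)`, on complex
points; the identity and the point `(0, 0)` (the only point with `x = 0`) are sent to the
identity. -/
noncomputable def isogeny : EC → EC'
  | .zero => 0
  | .some x _ h =>
    if hx : x = 0 then 0 else .some _ _ (E'_nonsingular (isogeny_equation h hx))

/-- The torsion subgroup `A[m]` of an abelian group. -/
noncomputable abbrev tors (A : Type) [AddCommGroup A] (m : ℕ) : AddSubgroup A :=
  AddSubgroup.torsionBy A (m : ℤ)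

/-- `A[m]` is a module over `ℤ / m`. -/
noncomputable instance torsModule (A : Type) [AddCommGroup A] (m : ℕ) : Module (ZMod m) (tors A m) :=
  AddSubgroup.torsionBy.zmodModule

/-- A compatible system of bases `(A_k, B_k)` of `E[2^k]` and `(C_k, D_k)` of `E'[2^k]` over
`ℤ / 2^k`, with `2 A_{k+1} = A_k`, `2 B_{k+1} = B_k`, `2 C_{k+1} = C_k`, `2 D_{k+1} = D_k`,
`φ(A_k) = C_k` and `φ(B_k) = 2 D_k`. Here `A_k, B_k` are the values of `basisE k` at `0, 1`, and
`C_k, D_k` are the values of `basisE' k` at `0, 1`. (For `k = 0` all groups are trivial.) -/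
structure AdaptedBases where
  basisE : ∀ k : ℕ, Module.Basis (Fin 2) (ZMod (2 ^ k)) (tors EC (2 ^ k))
  basisE' : ∀ k : ℕ, Module.Basis (Fin 2) (ZMod (2 ^ k)) (tors EC' (2 ^ k))
  two_nsmul_basisE : ∀ k i, 2 • (basisE (k + 1) i : EC) = basisE k i
  two_nsmul_basisE' : ∀ k i, 2 • (basisE' (k + 1) i : EC') = basisE' k i
  isogeny_A : ∀ k, isogeny (basisE k 0) = basisE' k 0
  isogeny_B : ∀ k, isogeny (basisE k 1) = 2 • (basisE' k 1 : EC')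

/-- The field `K_k`, obtained by adjoining to `ℚ` the coordinates of all points `β` of `E(ℂ)` with
`2^k β = P`. -/
noncomputable def K (k : ℕ) : IntermediateField ℚ ℂ :=
  IntermediateField.adjoin ℚ
    {z | ∃ (x y : ℂ) (h : (E⁄ℂ).Nonsingular x y),
      2 ^ k • (WeierstrassCurve.Affine.Point.some x y h : EC) = P ∧ (z = x ∨ z = y)}

/-- The inclusion `E(K_k) → E(ℂ)`. -/
noncomputable def incl (k : ℕ) : (E⁄(K k)).Point →+ EC := WeierstrassCurve.Affine.Point.map (K k).val

theorem incl_injective (k : ℕ) : Function.Injective (incl k) :=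
  WeierstrassCurve.Affine.Point.map_injective _

/-- The coordinatewise action of `σ ∈ Gal(K_k / ℚ)` on `E(K_k)`. -/
noncomputable def galPoint {k : ℕ} (σ : K k ≃ₐ[ℚ] K k) : (E⁄(K k)).Point →+ (E⁄(K k)).Point :=
  WeierstrassCurve.Affine.Point.map (σ : K k →ₐ[ℚ] K k)

/-- The action of `σ ∈ Gal(K_k / ℚ)` on the points of `E(ℂ)` with coordinates in `K_k`, that is, on
the image of `E(K_k)` in `E(ℂ)`. -/
noncomputable def galAct {k : ℕ} (σ : K k ≃ₐ[ℚ] K k) : (incl k).range →+ EC :=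
  ((incl k).comp (galPoint σ)).comp
    (AddMonoidHom.ofInjective (incl_injective k)).symm.toAddMonoidHom

theorem galAct_incl {k : ℕ} (σ : K k ≃ₐ[ℚ] K k) (X : (E⁄(K k)).Point)
    (h : incl k X ∈ (incl k).range) : galAct σ ⟨incl k X, h⟩ = incl k (galPoint σ X) := by
  have : (⟨incl k X, h⟩ : (incl k).range) = AddMonoidHom.ofInjective (incl_injective k) X := rfl
  rw [this]
  simp [galAct]

theorem galPoint_mul {k : ℕ} (σ τ : K k ≃ₐ[ℚ] K k) (X : (E⁄(K k)).Point) :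
    galPoint (σ * τ) X = galPoint σ (galPoint τ X) := by
  cases X <;> rfl

theorem galPoint_one {k : ℕ} (X : (E⁄(K k)).Point) :
    galPoint (1 : K k ≃ₐ[ℚ] K k) X = X := by
  cases X <;> rfl

theorem mem_range_of_nsmul {k : ℕ} {β : EC} (hβ : 2 ^ k • β = P) : β ∈ (incl k).range := by
  rcases β with _ | ⟨x, y, h⟩
  · exact ⟨0, rfl⟩
  · have hx : x ∈ K k := IntermediateField.subset_adjoin _ _ ⟨x, y, h, hβ, Or.inl rfl⟩
    have hy : y ∈ K k := IntermediateField.subset_adjoin _ _ ⟨x, y, h, hβ, Or.inr rfl⟩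
    exact ⟨.some (⟨x, hx⟩ : K k) (⟨y, hy⟩ : K k)
      ((E.baseChange_nonsingular (K k).val.injective ⟨x, hx⟩ ⟨y, hy⟩).mp h), rfl⟩

theorem mem_tors_iff {k : ℕ} {T : EC} : T ∈ tors EC (2 ^ k) ↔ 2 ^ k • T = 0 := by
  exact AddSubgroup.torsionBy.nsmul_iff

theorem tors_mem_range {k : ℕ} {β : EC} (hβ : 2 ^ k • β = P) {T : EC}
    (hT : T ∈ tors EC (2 ^ k)) : T ∈ (incl k).range := by
  have h1 : β + T ∈ (incl k).range :=
    mem_range_of_nsmul (by rw [nsmul_add, hβ, mem_tors_iff.mp hT, add_zero])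
  simpa using sub_mem h1 (mem_range_of_nsmul hβ)

theorem galAct_P {k : ℕ} (σ : K k ≃ₐ[ℚ] K k) {β : EC} (hβ : 2 ^ k • β = P) :
    2 ^ k • galAct σ ⟨β, mem_range_of_nsmul hβ⟩ = P := by
  have hP : ∃ X : (E⁄(K k)).Point, incl k X = P ∧ galPoint σ X = X := by
    refine ⟨.some (2 : K k) (2 : K k)
      ((E.baseChange_nonsingular (K k).val.injective 2 2).mp ?_), ?_, ?_⟩
    · exact E_nonsingular ((E_equation_iff _ _).mpr (by rw [map_ofNat]; norm_num))
    · simp only [incl, P, WeierstrassCurve.Affine.Point.map_some, map_ofNat]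
    · simp only [galPoint, WeierstrassCurve.Affine.Point.map_some, map_ofNat]
  obtain ⟨X, hX, hσ⟩ := hP
  obtain ⟨Y, rfl⟩ := mem_range_of_nsmul hβ
  have hY : 2 ^ k • Y = X := incl_injective k (by rw [map_nsmul, hβ, hX])
  have h := galAct_incl σ Y ⟨Y, rfl⟩
  calc 2 ^ k • galAct σ ⟨incl k Y, mem_range_of_nsmul hβ⟩
      = 2 ^ k • incl k (galPoint σ Y) := congrArg (2 ^ k • ·) h
    _ = P := by rw [← map_nsmul, ← map_nsmul, hY, hσ, hX]

/-- The action of `σ ∈ Gal(K_k / ℚ)` on `E[2^k]` (all of whose points have coordinates in `K_k`,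
being differences of two points `β` with `2^k β = P`). -/
noncomputable def galTors {k : ℕ} (σ : K k ≃ₐ[ℚ] K k) {β : EC} (hβ : 2 ^ k • β = P) :
    tors EC (2 ^ k) →+ tors EC (2 ^ k) where
  toFun T := ⟨galAct σ ⟨T, tors_mem_range hβ T.2⟩, by
    rw [mem_tors_iff, ← map_nsmul]
    convert map_zero (galAct σ)
    exact Subtype.ext (mem_tors_iff.mp T.2)⟩
  map_zero' := Subtype.ext (map_zero (galAct σ))
  map_add' S T := Subtype.ext (map_add (galAct σ) ⟨S, tors_mem_range hβ S.2⟩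
    ⟨T, tors_mem_range hβ T.2⟩)

theorem galTors_mul {k : ℕ} (σ τ : K k ≃ₐ[ℚ] K k) {β : EC} (hβ : 2 ^ k • β = P)
    (T : tors EC (2 ^ k)) : galTors (σ * τ) hβ T = galTors σ hβ (galTors τ hβ T) := by
  obtain ⟨T, hT⟩ := T
  obtain ⟨Y, rfl⟩ := tors_mem_range hβ hT
  apply Subtype.ext
  simp [galTors, galAct_incl, galPoint_mul]

theorem galTors_one {k : ℕ} {β : EC} (hβ : 2 ^ k • β = P) (T : tors EC (2 ^ k)) :
    galTors (1 : K k ≃ₐ[ℚ] K k) hβ T = T := by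
  obtain ⟨T, hT⟩ := T
  obtain ⟨Y, rfl⟩ := tors_mem_range hβ hT
  apply Subtype.ext
  simp [galTors, galAct_incl, galPoint_one]

/-- The matrix `M` of `σ` acting on `E[2^k]`: its rows are the coordinates of `σ(A_k)` and
`σ(B_k)`, so that `σ(A_k) = a A_k + b B_k` and `σ(B_k) = c A_k + d B_k` for `M = [a, b; c, d]`. -/
noncomputable def tauMatrix (𝔅 : AdaptedBases) {k : ℕ} {β : EC} (hβ : 2 ^ k • β = P) (σ : K k ≃ₐ[ℚ] K k) :
    Matrix (Fin 2) (Fin 2) (ZMod (2 ^ k)) :=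
  Matrix.of fun i j => (𝔅.basisE k).repr (galTors σ hβ (𝔅.basisE k i)) j

theorem tauMatrix_mul (𝔅 : AdaptedBases) {k : ℕ} {β : EC} (hβ : 2 ^ k • β = P)
    (σ τ : K k ≃ₐ[ℚ] K k) :
    tauMatrix 𝔅 hβ (σ * τ) = tauMatrix 𝔅 hβ τ * tauMatrix 𝔅 hβ σ := by
  ext i j
  have h := (𝔅.basisE k).sum_repr (galTors τ hβ (𝔅.basisE k i))
  simp only [tauMatrix, Matrix.of_apply, Matrix.mul_apply, galTors_mul]
  conv_lhs => rw [← h]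
  simp only [map_sum, ZMod.map_smul, map_smul, Finsupp.coe_finsetSum, Finset.sum_apply,
    Finsupp.coe_smul, Pi.smul_apply, smul_eq_mul]

theorem tauMatrix_one (𝔅 : AdaptedBases) {k : ℕ} {β : EC} (hβ : 2 ^ k • β = P) :
    tauMatrix 𝔅 hβ (1 : K k ≃ₐ[ℚ] K k) = 1 := by
  ext i j
  simp [tauMatrix, galTors_one, Finsupp.single_apply, Matrix.one_apply]

/-- The element `τ(σ) = M` of `GL₂(ℤ / 2^k)`. -/
noncomputable def tau (𝔅 : AdaptedBases) {k : ℕ} {β : EC} (hβ : 2 ^ k • β = P) (σ : K k ≃ₐ[ℚ] K k) :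
    GL (Fin 2) (ZMod (2 ^ k)) where
  val := tauMatrix 𝔅 hβ σ
  inv := tauMatrix 𝔅 hβ σ⁻¹
  val_inv := by rw [← tauMatrix_mul, inv_mul_cancel, tauMatrix_one]
  inv_val := by rw [← tauMatrix_mul, mul_inv_cancel, tauMatrix_one]

/-- `σ(β) - β`, as an element of `E[2^k]`. -/
noncomputable def kummer {k : ℕ} {β : EC} (hβ : 2 ^ k • β = P) (σ : K k ≃ₐ[ℚ] K k) : tors EC (2 ^ k) :=
  ⟨galAct σ ⟨β, mem_range_of_nsmul hβ⟩ - β, by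
    rw [mem_tors_iff, nsmul_sub, galAct_P σ hβ, hβ, sub_self]⟩

/-- The elements `(v, M)` of `AGL₂(ℤ / m)`, where `v` is a row vector and `M ∈ GL₂(ℤ / m)`. -/
@[ext] structure AGL2 (m : ℕ) where
  v : Fin 2 → ZMod m
  M : GL (Fin 2) (ZMod m)

/-- The group operation `(v₁, M₁) * (v₂, M₂) = (v₁ + v₂ M₁, M₂ M₁)`. -/
noncomputable instance (m : ℕ) : Mul (AGL2 m) :=
  ⟨fun g h => ⟨g.v + Matrix.vecMul h.v (g.M : Matrix (Fin 2) (Fin 2) (ZMod m)), h.M * g.M⟩⟩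

/-- The map `ρ_{E,2^k} : Gal(K_k / ℚ) → AGL₂(ℤ / 2^k)`, `σ ↦ ((e, f), M)`, attached to a point `β`
with `2^k β = P` and to the basis `A_k, B_k` of `E[2^k]`: here `σ(β) = β + e A_k + f B_k`, and `M`
is the matrix of `σ` on `E[2^k]`. -/
noncomputable def rho (𝔅 : AdaptedBases) {k : ℕ} {β : EC} (hβ : 2 ^ k • β = P) (σ : K k ≃ₐ[ℚ] K k) :
    AGL2 (2 ^ k) where
  v := fun i => (𝔅.basisE k).repr (kummer hβ σ) i
  M := tau 𝔅 hβ σ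

theorem rho_mul (𝔅 : AdaptedBases) {k : ℕ} {β : EC} (hβ : 2 ^ k • β = P)
    (σ τ : K k ≃ₐ[ℚ] K k) : rho 𝔅 hβ (σ * τ) = rho 𝔅 hβ σ * rho 𝔅 hβ τ := by
  have key : kummer hβ (σ * τ) = kummer hβ σ + galTors σ hβ (kummer hβ τ) := by
    obtain ⟨Y, rfl⟩ := mem_range_of_nsmul hβ
    apply Subtype.ext
    have hk : ∀ ν : K k ≃ₐ[ℚ] K k, (kummer hβ ν : EC) = incl k (galPoint ν Y - Y) := fun ν => by
      rw [map_sub, ← galAct_incl ν Y ⟨Y, rfl⟩]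
      rfl
    have hg : (galTors σ hβ (kummer hβ τ) : EC) = incl k (galPoint σ (galPoint τ Y - Y)) := by
      rw [← galAct_incl σ _ ⟨_, rfl⟩]
      exact congrArg (galAct σ) (Subtype.ext (hk τ))
    rw [AddSubgroup.coe_add, hk, hk, hg, ← map_add, galPoint_mul, map_sub (galPoint σ)]
    congr 1
    abel
  apply AGL2.ext
  · funext i
    have h := (𝔅.basisE k).sum_repr (kummer hβ τ)
    change (𝔅.basisE k).repr (kummer hβ (σ * τ)) i = (𝔅.basisE k).repr (kummer hβ σ) i +
      Matrix.vecMul (fun i => (𝔅.basisE k).repr (kummer hβ τ) i) (tauMatrix 𝔅 hβ σ) i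
    rw [key]
    conv_lhs => rw [← h]
    simp only [map_add, map_sum, ZMod.map_smul, map_smul, Finsupp.coe_finsetSum, Finset.sum_apply,
      Finsupp.coe_add, Pi.add_apply, Finsupp.coe_smul, Pi.smul_apply, smul_eq_mul, Matrix.vecMul,
      dotProduct, tauMatrix, Matrix.of_apply]
  · exact Units.ext (tauMatrix_mul 𝔅 hβ σ τ)

end SomosFive

/-!
Both the parity of `e` and the class of `det M` modulo `8` are read off from a square root of `2`
written as a rational function of the coordinates of suitable points, with coefficients in `ℚ`.
Such functions commute with the Galois action, so it is enough to know their values at the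
conjugate points, and this is a matter of the group law only.

The building blocks are the functions `rootDouble x(T)`, for `T` a point of order two, whose
square at `Q` is `x(2Q) - x(T)`. Translation by a point `S` of order two multiplies
`rootDouble x(T)` by the Weil pairing of `S` and `T`, that is by `1` if `S = T` and by `-1`
otherwise (`rootDouble_add_self`, `rootDouble_add_of_ne`).

For `e`: the condition on `B₁` forces `B₁ = (0, 0)`, so `rootDouble 0` has square `x(P) = 2` at the
half `2 ^ (k - 1) β` of `P`. The automorphism `σ` adds `e A₁ + f B₁` to this half and hence
multiplies this value by `(-1) ^ e` (`exists_sqrtTwo_kummer`).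

For `det M`: it is classical that `σ` raises the Weil pairing `e₈(A₃, B₃)`, a primitive eighth root
of unity `ζ`, to the power `det M`, so that `√2 = ± (ζ + ζ⁻¹)` is fixed if and only if
`det M ≡ ± 1` modulo `8`. The Weil pairing itself is avoided: `sqrtTwo A B` is an explicit
expression in the values of functions `rootDouble` at points built from `A` and `B`, its square
is `2`, and it is multiplied by the quadratic character `χ₈` of the determinant under every change
of basis that fixes `4B = (0, 0)` (`IsAdapted.sqrtTwo_basis_change`). The matrices in question are
products of diagonal matrices and of the elementary matrices for `A ↦ A + B` and `B ↦ B + 2A`. The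
diagonal ones only involve translations by points of order two; the other two rest on
`rootDouble_mul_add_half` and on `rootDouble_mul_mul_add`, which fixes the sign in the
multiplicativity of the square root of `x ∘ [2]`.
-/

namespace SomosFive

open scoped Classical WeierstrassCurve.Affine

/-! ### The coordinates `x` and `η` -/

section Coordinates

variable {F : Type*} [Field F] [Algebra ℚ F]

/-- The `x`-coordinate of a point of `E`, with value `0` at the identity. -/
def xCoord : (E⁄F).Point → F
  | .zero => 0
  | .some x _ _ => x

/-- The coordinate `η = 2y + x`, in which `E` becomes `η² = 4x³ + 5x² - 8x` and negation is
`η ↦ -η`; its value at the identity is `0`. -/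
def eta : (E⁄F).Point → F
  | .zero => 0
  | .some x y _ => 2 * y + x

/-- A square root of `x(2Q) - e`, where `e` is the `x`-coordinate of a point of order two: the
constant `3e² + 5e/2 - 2` is `(e - e')(e - e'')` for the other two such coordinates `e'`, `e''`.
The value at points with `2Q = 0` is `0`. -/
noncomputable def rootDouble (e : F) (Q : (E⁄F).Point) : F :=
  ((xCoord Q - e) ^ 2 - (3 * e ^ 2 + 5 / 2 * e - 2)) / eta Q

variable {F' : Type*} [Field F'] [Algebra ℚ F'] [DecidableEq F] [DecidableEq F'] (g : F →ₐ[ℚ] F')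

theorem xCoord_map (Q : (E⁄F).Point) :
    xCoord (WeierstrassCurve.Affine.Point.map g Q) = g (xCoord Q) := by
  cases Q
  · exact (map_zero g).symm
  · rfl

theorem eta_map (Q : (E⁄F).Point) :
    eta (WeierstrassCurve.Affine.Point.map g Q) = g (eta Q) := by
  cases Q
  · exact (map_zero g).symm
  · rw [WeierstrassCurve.Affine.Point.map_some]
    simp [eta, map_ofNat g]

theorem rootDouble_map (e : F) (Q : (E⁄F).Point) :
    rootDouble (g e) (WeierstrassCurve.Affine.Point.map g Q) = g (rootDouble e Q) := by
  simp [rootDouble, xCoord_map, eta_map, map_ofNat g]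

end Coordinates

theorem eta_sq {Q : EC} : eta Q ^ 2 = 4 * xCoord Q ^ 3 + 5 * xCoord Q ^ 2 - 8 * xCoord Q := by
  rcases Q with _ | ⟨x, y, h⟩
  · simp [eta, xCoord]
  · have := (E_equation_iff x y).mp h.1
    simp only [eta, xCoord]
    linear_combination 4 * this

theorem xCoord_neg (Q : EC) : xCoord (-Q) = xCoord Q := by
  rcases Q with _ | ⟨x, y, h⟩ <;> rfl

theorem eta_neg (Q : EC) : eta (-Q) = -eta Q := by
  rcases Q with _ | ⟨x, y, h⟩
  · exact neg_zero.symm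
  · rw [WeierstrassCurve.Affine.Point.neg_some]
    simp [eta, WeierstrassCurve.Affine.negY, E, WeierstrassCurve.Affine.baseChange]
    ring

theorem eq_of_coords {Q R : EC} (hQ : Q ≠ 0) (hR : R ≠ 0) (hx : xCoord Q = xCoord R)
    (he : eta Q = eta R) : Q = R := by
  rcases Q with _ | ⟨x, y, h⟩
  · exact absurd rfl hQ
  rcases R with _ | ⟨x', y', h'⟩
  · exact absurd rfl hR
  simp only [xCoord, eta] at hx he
  subst hx
  have : y = y' := by linear_combination he / 2
  subst this
  rfl

theorem eq_or_eq_neg {Q R : EC} (hQ : Q ≠ 0) (hR : R ≠ 0) (hx : xCoord Q = xCoord R) :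
    Q = R ∨ Q = -R := by
  have h : (eta Q - eta R) * (eta Q + eta R) = 0 := by
    have h1 := eta_sq (Q := Q)
    have h2 := eta_sq (Q := R)
    rw [hx] at h1
    linear_combination h1 - h2
  rcases mul_eq_zero.mp h with h | h
  · exact .inl (eq_of_coords hQ hR hx (sub_eq_zero.mp h))
  · exact .inr (eq_of_coords hQ (neg_ne_zero.mpr hR) (by rw [hx, xCoord_neg])
      (by rw [eta_neg]; exact eq_neg_of_add_eq_zero_left h))

theorem eta_eq_zero_iff {Q : EC} : eta Q = 0 ↔ 2 • Q = 0 := by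
  by_cases hQ : Q = 0
  · subst hQ
    simp [eta, show (0 : EC) = .zero from rfl]
    rfl
  rw [two_nsmul, add_eq_zero_iff_eq_neg]
  constructor
  · intro h
    exact eq_of_coords hQ (neg_ne_zero.mpr hQ) (xCoord_neg Q).symm (by rw [eta_neg, h, neg_zero])
  · intro h
    have := eta_neg Q
    rw [← h] at this
    linear_combination this / 2

/-- The addition law in the coordinates `x`, `η` for points that are not equal or opposite. -/
theorem coords_add {Q R : EC} (hQ : Q ≠ 0) (hR : R ≠ 0) (hx : xCoord Q ≠ xCoord R) :
    ∃ l, l * (xCoord Q - xCoord R) = eta Q - eta R ∧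
      xCoord (Q + R) = (l ^ 2 - 5) / 4 - xCoord Q - xCoord R ∧
      eta (Q + R) = -(eta Q + l * (xCoord (Q + R) - xCoord Q)) := by
  rcases Q with _ | ⟨x, y, h⟩
  · exact absurd rfl hQ
  rcases R with _ | ⟨x', y', h'⟩
  · exact absurd rfl hR
  simp only [xCoord] at hx
  have hx' : x - x' ≠ 0 := sub_ne_zero.mpr hx
  rw [WeierstrassCurve.Affine.Point.add_of_X_ne hx]
  simp only [xCoord, eta, WeierstrassCurve.Affine.slope_of_X_ne hx]
  refine ⟨2 * ((y - y') / (x - x')) + 1, ?_, ?_, ?_⟩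
  · field_simp
    ring
  · simp [WeierstrassCurve.Affine.addX, E, WeierstrassCurve.Affine.baseChange]
    ring
  · simp [WeierstrassCurve.Affine.addX, WeierstrassCurve.Affine.addY,
      WeierstrassCurve.Affine.negAddY, WeierstrassCurve.Affine.negY, E,
      WeierstrassCurve.Affine.baseChange]
    ring

/-- The duplication law in the coordinates `x`, `η`. -/
theorem coords_double {Q : EC} (hQ : 2 • Q ≠ 0) :
    ∃ l, l * eta Q = 6 * xCoord Q ^ 2 + 5 * xCoord Q - 4 ∧
      xCoord (2 • Q) = (l ^ 2 - 5) / 4 - 2 * xCoord Q ∧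
      eta (2 • Q) = -(eta Q + l * (xCoord (2 • Q) - xCoord Q)) := by
  have he : eta Q ≠ 0 := fun h => hQ (eta_eq_zero_iff.mp h)
  rcases Q with _ | ⟨x, y, h⟩
  · exact absurd rfl he
  simp only [eta] at he
  have hy : y ≠ (E⁄ℂ).negY x y := by
    intro h0
    apply he
    simp [WeierstrassCurve.Affine.negY, E, WeierstrassCurve.Affine.baseChange] at h0
    linear_combination h0
  have hd : y - (E⁄ℂ).negY x y = 2 * y + x := by
    simp [WeierstrassCurve.Affine.negY, E, WeierstrassCurve.Affine.baseChange]
    ring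
  rw [two_nsmul, WeierstrassCurve.Affine.Point.add_self_of_Y_ne hy]
  simp only [xCoord, eta, WeierstrassCurve.Affine.slope_of_Y_ne rfl hy, hd]
  refine ⟨2 * ((3 * x ^ 2 + 2 * x - 2 - y) / (2 * y + x)) + 1, ?_, ?_, ?_⟩
  · field_simp
    ring
  · simp [WeierstrassCurve.Affine.addX, E, WeierstrassCurve.Affine.baseChange]
    ring
  · simp [WeierstrassCurve.Affine.addX, WeierstrassCurve.Affine.addY,
      WeierstrassCurve.Affine.negAddY, WeierstrassCurve.Affine.negY, E,
      WeierstrassCurve.Affine.baseChange]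
    ring

/-! ### Square roots of `x(2Q) - x(T)` -/

theorem eta_ne_zero {Q : EC} (hQ : 2 • Q ≠ 0) : eta Q ≠ 0 :=
  fun h => hQ (eta_eq_zero_iff.mp h)

theorem ne_zero_of_two_nsmul {Q : EC} (hQ : 2 • Q ≠ 0) : Q ≠ 0 := by
  rintro rfl
  exact hQ (nsmul_zero 2)

theorem xCoord_twoTorsion {T : EC} (hT : 2 • T = 0) :
    4 * xCoord T ^ 3 + 5 * xCoord T ^ 2 - 8 * xCoord T = 0 := by
  rw [← eta_sq, eta_eq_zero_iff.mpr hT, zero_pow two_ne_zero]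

theorem neg_eq_self_of_two_nsmul {T : EC} (hT : 2 • T = 0) : -T = T :=
  neg_eq_of_add_eq_zero_left (by rwa [← two_nsmul])

theorem xCoord_ne_of_twoTorsion {Q T : EC} (hT : 2 • T = 0) (hT0 : T ≠ 0) (hQ : Q ≠ 0)
    (hQT : Q ≠ T) : xCoord Q ≠ xCoord T := fun h =>
  (eq_or_eq_neg hQ hT0 h).elim hQT fun h => hQT (h.trans (neg_eq_self_of_two_nsmul hT))

theorem ne_of_two_nsmul_ne {Q T : EC} (hQ : 2 • Q ≠ 0) (hT : 2 • T = 0) : Q ≠ T := by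
  rintro rfl
  exact hQ hT

theorem rootDouble_neg (e : ℂ) (Q : EC) : rootDouble e (-Q) = -rootDouble e Q := by
  rw [rootDouble, rootDouble, xCoord_neg, eta_neg, div_neg]

theorem rootDouble_sq {Q T : EC} (hQ : 2 • Q ≠ 0) (hT : 2 • T = 0) :
    rootDouble (xCoord T) Q ^ 2 = xCoord (2 • Q) - xCoord T := by
  obtain ⟨l, hl, hx, -⟩ := coords_double hQ
  have he := eta_ne_zero hQ
  have hq := eta_sq (Q := Q)
  have ht := xCoord_twoTorsion hT
  rw [hx, rootDouble, eq_div_iff_mul_eq he |>.mpr hl]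
  generalize xCoord T = t at *
  generalize xCoord Q = x at *
  generalize eta Q = n at *
  field_simp
  grind

/-- Translation by `T` fixes the function `√(x ∘ [2] - x(T))`: the Weil pairing of `T` with
itself is trivial. -/
theorem rootDouble_add_self {Q T : EC} (hQ : 2 • Q ≠ 0) (hT : 2 • T = 0) (hT0 : T ≠ 0) :
    rootDouble (xCoord T) (Q + T) = rootDouble (xCoord T) Q := by
  have hxne := xCoord_ne_of_twoTorsion hT hT0 (ne_zero_of_two_nsmul hQ) (ne_of_two_nsmul_ne hQ hT)
  obtain ⟨l, hl, hx, hn⟩ := coords_add (ne_zero_of_two_nsmul hQ) hT0 hxne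
  have he := eta_ne_zero hQ
  have he' : eta (Q + T) ≠ 0 := eta_ne_zero (by rwa [nsmul_add, hT, add_zero])
  have hq := eta_sq (Q := Q)
  have ht := xCoord_twoTorsion hT
  rw [eta_eq_zero_iff.mpr hT, sub_zero] at hl
  have hd := sub_ne_zero.mpr hxne
  rw [rootDouble, rootDouble, div_eq_div_iff he' he]
  generalize eta (Q + T) = n' at *
  generalize xCoord (Q + T) = x' at *
  generalize xCoord T = t at *
  generalize xCoord Q = x at *
  generalize eta Q = n at *
  subst hx
  subst hn
  clear hQ hT hT0 he'
  rw [eq_div_iff_mul_eq hd |>.mpr hl]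
  field_simp
  grind

/-- Translation by a point `S` of order two other than `T` changes the sign of
`√(x ∘ [2] - x(T))`: the Weil pairing of `S` and `T` is `-1`. -/
theorem rootDouble_add_of_ne {Q S T : EC} (hQ : 2 • Q ≠ 0) (hT : 2 • T = 0) (hT0 : T ≠ 0)
    (hS : 2 • S = 0) (hS0 : S ≠ 0) (hST : S ≠ T) :
    rootDouble (xCoord T) (Q + S) = -rootDouble (xCoord T) Q := by
  have hxne := xCoord_ne_of_twoTorsion hS hS0 (ne_zero_of_two_nsmul hQ) (ne_of_two_nsmul_ne hQ hS)
  have hst := sub_ne_zero.mpr (xCoord_ne_of_twoTorsion hT hT0 hS0 hST)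
  obtain ⟨l, hl, hx, hn⟩ := coords_add (ne_zero_of_two_nsmul hQ) hS0 hxne
  have he := eta_ne_zero hQ
  have he' : eta (Q + S) ≠ 0 := eta_ne_zero (by rwa [nsmul_add, hS, add_zero])
  have hq := eta_sq (Q := Q)
  have ht := xCoord_twoTorsion hT
  have hs := xCoord_twoTorsion hS
  rw [eta_eq_zero_iff.mpr hS, sub_zero] at hl
  have hd := sub_ne_zero.mpr hxne
  rw [rootDouble, rootDouble, ← neg_div, div_eq_div_iff he' he]
  generalize eta (Q + S) = n' at *
  generalize xCoord (Q + S) = x' at *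
  generalize xCoord T = t at *
  generalize xCoord S = s at *
  generalize xCoord Q = x at *
  generalize eta Q = n at *
  have hst' : 4 * (s ^ 2 + s * t + t ^ 2) + 5 * (s + t) - 8 = 0 := by
    apply mul_left_cancel₀ hst
    linear_combination hs - ht
  subst hx
  subst hn
  clear hQ hT hT0 he' hS hS0 hST hst hxne
  rw [eq_div_iff_mul_eq hd |>.mpr hl]
  field_simp
  clear hl hd he
  grind

theorem xCoord_half {R T : EC} (hR : 2 • R = T) (hT : 2 • T = 0) (hT0 : T ≠ 0) :
    (xCoord R - xCoord T) ^ 2 = 3 * xCoord T ^ 2 + 5 / 2 * xCoord T - 2 := by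
  have hR0 : 2 • R ≠ 0 := hR ▸ hT0
  have h := rootDouble_sq hR0 hT
  rw [hR, sub_self, sq_eq_zero_iff, rootDouble, div_eq_zero_iff] at h
  exact sub_eq_zero.mp (h.resolve_right (eta_ne_zero hR0))

/-- The product of the values of `√(x ∘ [2] - x(T))` at two points differing by a half `R`
of `T` depends only on `R`. -/
theorem rootDouble_mul_add_half {Q R T : EC} (hR : 2 • R = T) (hT : 2 • T = 0) (hT0 : T ≠ 0)
    (hQ : 2 • Q ≠ 0) (hQR : 2 • (Q + R) ≠ 0) :
    rootDouble (xCoord T) Q * rootDouble (xCoord T) (Q + R) = xCoord T - xCoord R := by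
  have hR2 : 2 • R ≠ 0 := hR ▸ hT0
  have hR0 : R ≠ 0 := ne_zero_of_two_nsmul hR2
  have hxne : xCoord Q ≠ xCoord R := fun h =>
    (eq_or_eq_neg (ne_zero_of_two_nsmul hQ) hR0 h).elim
      (fun h => hQR (by rw [h, nsmul_add, hR, ← two_nsmul, hT]))
      (fun h => hQR (by rw [h, neg_add_cancel, nsmul_zero]))
  obtain ⟨l, hl, hx, hn⟩ := coords_add (ne_zero_of_two_nsmul hQ) hR0 hxne
  have he := eta_ne_zero hQ
  have he' := eta_ne_zero hQR
  have hq := eta_sq (Q := Q)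
  have hr := eta_sq (Q := R)
  have ht := xCoord_twoTorsion hT
  have hh := xCoord_half hR hT hT0
  have hd := sub_ne_zero.mpr hxne
  rw [rootDouble, rootDouble, div_mul_div_comm, div_eq_iff (mul_ne_zero he he')]
  generalize eta (Q + R) = n' at *
  generalize xCoord (Q + R) = x' at *
  generalize xCoord T = t at *
  generalize xCoord Q = x at *
  generalize eta Q = n at *
  generalize xCoord R = r at *
  generalize eta R = m at *
  subst hx
  subst hn
  clear hQ hR hT hT0 hQR he he' hR2 hR0 hxne
  rw [eq_div_iff_mul_eq hd |>.mpr hl]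
  field_simp
  clear hl hd
  grind


/-- If `T₁`, `T₂`, `T₃` are the points of order two, the product of the functions
`√(x ∘ [2] - x(Tᵢ))` is half of `η ∘ [2]`. Here `T₂` is the point with `x = 0`. -/
theorem rootDouble_mul_mul {Q : EC} (hQ : 2 • Q ≠ 0) {e₁ e₃ : ℂ} (hsum : e₁ + e₃ = -5 / 4)
    (hprod : e₁ * e₃ = -2) :
    2 * (rootDouble e₁ Q * rootDouble 0 Q * rootDouble e₃ Q) = eta (2 • Q) := by
  obtain ⟨l, hl, hx, hn⟩ := coords_double hQ
  have he := eta_ne_zero hQ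
  have hq := eta_sq (Q := Q)
  rw [hn, hx, rootDouble, rootDouble, rootDouble, eq_div_iff_mul_eq he |>.mpr hl]
  generalize xCoord Q = x at *
  generalize eta Q = n at *
  field_simp
  clear hl he hn hx hQ
  obtain rfl : e₃ = -5 / 4 - e₁ := by linear_combination hsum
  clear hsum
  grind

/-! ### Multiplicativity of the square root of `x(2Q)` -/

/-- The identity behind `rootDouble_mul_mul_add`. Three collinear points of
`η² = 4x³ + Ax² + 4Bx` are written as `(rᵢ², nᵢ)`; this rationalises the family, as the product
of their `x`-coordinates is the square of half the intercept `2r₁r₂r₃` of the line. -/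
theorem collinear_doubling_identity {l r₁ r₂ r₃ A B n₁ n₂ n₃ N₁ N₂ : ℂ}
    (hA : A = l ^ 2 - 4 * (r₁ ^ 2 + r₂ ^ 2 + r₃ ^ 2))
    (hB : B = l * r₁ * r₂ * r₃ + r₁ ^ 2 * r₂ ^ 2 + r₂ ^ 2 * r₃ ^ 2 + r₁ ^ 2 * r₃ ^ 2)
    (hn₁ : n₁ = r₁ * (l * r₁ + 2 * r₂ * r₃)) (hn₂ : n₂ = r₂ * (l * r₂ + 2 * r₁ * r₃))
    (hn₃ : n₃ = r₃ * (l * r₃ + 2 * r₁ * r₂)) (h₁ : n₁ ≠ 0) (h₂ : n₂ ≠ 0) (h₃ : n₃ ≠ 0)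
    (hN₁ : N₁ = -(n₁ + (6 * r₁ ^ 4 + A * r₁ ^ 2 + 2 * B) / n₁ *
      (((r₁ ^ 4 - B) / n₁) ^ 2 - r₁ ^ 2)))
    (hN₂ : N₂ = -(n₂ + (6 * r₂ ^ 4 + A * r₂ ^ 2 + 2 * B) / n₂ *
      (((r₂ ^ 4 - B) / n₂) ^ 2 - r₂ ^ 2))) :
    (r₁ ^ 4 - B) / n₁ * ((r₂ ^ 4 - B) / n₂) * ((r₃ ^ 4 - B) / n₃) *
        (2 * (((r₁ ^ 4 - B) / n₁) ^ 2 - ((r₂ ^ 4 - B) / n₂) ^ 2)) =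
      N₂ * ((r₁ ^ 4 - B) / n₁) ^ 2 - N₁ * ((r₂ ^ 4 - B) / n₂) ^ 2 := by
  rw [hN₁, hN₂]
  field_simp
  rw [hn₁, hn₂, hn₃, hA, hB]
  ring

theorem xCoord_ne_zero {Q : EC} (hQ : 2 • Q ≠ 0) : xCoord Q ≠ 0 := by
  intro h
  apply eta_ne_zero hQ
  rw [← sq_eq_zero_iff, eta_sq, h]
  ring

/-- The square roots of `x(2Q)`, `x(2R)` and `x(2Q + 2R)` chosen by `rootDouble 0` multiply to
the intercept of the line through `2Q` and `2R`, with a fixed sign. -/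
theorem rootDouble_mul_mul_add {Q R : EC} (hQ : 2 • Q ≠ 0) (hR : 2 • R ≠ 0)
    (hadd : 2 • (Q + R) ≠ 0) (hne : Q ≠ R) :
    rootDouble 0 Q * rootDouble 0 R * rootDouble 0 (Q + R) *
        (2 * (xCoord (2 • Q) - xCoord (2 • R))) =
      eta (2 • Q) * xCoord (2 • R) - eta (2 • R) * xCoord (2 • Q) := by
  have hQ0 := ne_zero_of_two_nsmul hQ
  have hR0 := ne_zero_of_two_nsmul hR
  have hxne : xCoord Q ≠ xCoord R := fun h => (eq_or_eq_neg hQ0 hR0 h).elim hne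
    fun h => hadd (by rw [h, neg_add_cancel, nsmul_zero])
  obtain ⟨l, hl, hx, hn⟩ := coords_add hQ0 hR0 hxne
  have hZ : 2 • (0 : EC) = 0 := nsmul_zero 2
  have hsq₁ := rootDouble_sq (T := 0) hQ hZ
  have hsq₂ := rootDouble_sq (T := 0) hR hZ
  have hx0 : xCoord (0 : EC) = 0 := rfl
  rw [hx0, sub_zero] at hsq₁ hsq₂
  obtain ⟨l₁, hl₁, -, hN₁⟩ := coords_double hQ
  obtain ⟨l₂, hl₂, -, hN₂⟩ := coords_double hR
  have he₁ := eta_ne_zero hQ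
  have he₂ := eta_ne_zero hR
  have he₃ := eta_ne_zero hadd
  have hq₁ := eta_sq (Q := Q)
  have hq₂ := eta_sq (Q := R)
  have hz₁ := xCoord_ne_zero hQ
  have hz₂ := xCoord_ne_zero hR
  obtain ⟨r₁, hr₁⟩ := IsSquare.exists_sq (xCoord Q) (IsAlgClosed.exists_eq_mul_self _)
  obtain ⟨r₂, hr₂⟩ := IsSquare.exists_sq (xCoord R) (IsAlgClosed.exists_eq_mul_self _)
  rw [← hsq₁, ← hsq₂]
  rw [← hsq₁, eq_div_iff_mul_eq he₁ |>.mpr hl₁] at hN₁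
  rw [← hsq₂, eq_div_iff_mul_eq he₂ |>.mpr hl₂] at hN₂
  unfold rootDouble at *
  generalize eta (2 • Q) = N₁ at *
  generalize eta (2 • R) = N₂ at *
  generalize eta (Q + R) = n₃ at *
  generalize xCoord (Q + R) = x₃ at *
  generalize xCoord Q = x₁ at *
  generalize xCoord R = x₂ at *
  generalize eta Q = n₁ at *
  generalize eta R = n₂ at *
  clear hsq₁ hsq₂ hl₁ hl₂
  have hd : x₁ - x₂ ≠ 0 := sub_ne_zero.mpr hxne
  -- the line through the two points is `η = l x + ν`
  obtain ⟨ν, hν⟩ : ∃ ν, ν = n₁ - l * x₁ := ⟨_, rfl⟩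
  have hn₂ : n₂ = l * x₂ + ν := by linear_combination hl - hν
  have hn₁ : n₁ = l * x₁ + ν := by linear_combination - hν
  have hB : l * ν / 2 + x₁ * x₂ + x₂ * x₃ + x₁ * x₃ = -2 := by
    apply mul_left_cancel₀ hd
    subst hn₁ hn₂ hx
    linear_combination (hq₁ - hq₂) / 4
  have hprod : ν ^ 2 = 4 * x₁ * x₂ * x₃ := by
    subst hn₁ hn₂ hx
    linear_combination hq₁ - 4 * x₁ * hB
  have hr₁0 : r₁ ≠ 0 := by rintro rfl; exact hz₁ (by simpa using hr₁)
  have hr₂0 : r₂ ≠ 0 := by rintro rfl; exact hz₂ (by simpa using hr₂)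
  obtain ⟨r₃, hr₃⟩ : ∃ r₃, ν = 2 * r₁ * r₂ * r₃ := ⟨ν / (2 * r₁ * r₂), by field_simp⟩
  have hx₃ : x₃ = r₃ ^ 2 := by
    apply mul_left_cancel₀ (mul_ne_zero hz₁ hz₂)
    rw [hr₃] at hprod
    rw [hr₁, hr₂] at hprod ⊢
    linear_combination -hprod / 4
  subst hr₁ hr₂ hx₃ hr₃
  have key := collinear_doubling_identity (l := l) (r₁ := r₁) (r₂ := r₂) (r₃ := r₃) (A := 5)
    (B := -2) (n₁ := n₁) (n₂ := n₂) (n₃ := -n₃) (N₁ := N₁) (N₂ := N₂)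
    (by linear_combination 4 * hx) (by linear_combination -hB) (by linear_combination hn₁)
    (by linear_combination hn₂) (by linear_combination -hn + hn₁) he₁ he₂ (neg_ne_zero.mpr he₃)
    (by rw [hN₁]; ring) (by rw [hN₂]; ring)
  linear_combination -key

/-! ### A square root of two in terms of the `8`-torsion -/

/-- Points `A`, `B` of `E` of order dividing `8` that are independent (as `4A`, `4B` are), with
`4B` the point `(0, 0)`. -/
structure IsAdapted (A B : EC) : Prop where
  eight_A : 8 • A = 0
  eight_B : 8 • B = 0
  four_A : 4 • A ≠ 0
  four_B : 4 • B ≠ 0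
  ne : 4 • A ≠ 4 • B
  x_four_B : xCoord (4 • B) = 0

/-- For a basis `A`, `B` of `E[8]` with `4B = (0, 0)` this is a square root of `2`, obtained as
the product of `(rootDouble 0 A + rootDouble 0 (A + 2B)) / rootDouble e B`, a square root of `-2`,
and `rootDouble e (2B) / rootDouble 0 (2A)`, a square root of `-1`, where `e = x(4A)`. -/
noncomputable def sqrtTwo {F : Type*} [Field F] [Algebra ℚ F] [DecidableEq F]
    (A B : (E⁄F).Point) : F :=
  (rootDouble 0 A + rootDouble 0 (A + 2 • B)) * rootDouble (xCoord (4 • A)) (2 • B) /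
    (rootDouble (xCoord (4 • A)) B * rootDouble 0 (2 • A))

theorem sqrtTwo_map {F F' : Type*} [Field F] [Algebra ℚ F] [Field F'] [Algebra ℚ F']
    [DecidableEq F] [DecidableEq F'] (g : F →ₐ[ℚ] F') (A B : (E⁄F).Point) :
    sqrtTwo (WeierstrassCurve.Affine.Point.map g A) (WeierstrassCurve.Affine.Point.map g B) =
      g (sqrtTwo A B) := by
  have h0 : ∀ Q : (E⁄F).Point, rootDouble 0 (WeierstrassCurve.Affine.Point.map g Q) =
      g (rootDouble 0 Q) := fun Q => by rw [← rootDouble_map, map_zero]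
  simp only [sqrtTwo, ← map_nsmul, ← map_add, xCoord_map, rootDouble_map, h0, map_mul, map_div₀]

theorem four_nsmul_eq (Q : EC) : 4 • Q = 2 • 2 • Q := by
  rw [smul_smul]
  rfl

theorem two_nsmul_ne_of_four {Q : EC} (h : 4 • Q ≠ 0) : 2 • Q ≠ 0 := by
  rw [four_nsmul_eq] at h
  exact ne_zero_of_two_nsmul h

namespace IsAdapted

variable {A B : EC}

theorem two_four_A (h : IsAdapted A B) : 2 • 4 • A = 0 := by rw [smul_smul]; exact h.eight_A

theorem two_four_B (h : IsAdapted A B) : 2 • 4 • B = 0 := by rw [smul_smul]; exact h.eight_B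

theorem four_add_two (h : IsAdapted A B) : 4 • (A + 2 • B) = 4 • A := by
  linear_combination (norm := module) h.eight_B

theorem four_add_two' (h : IsAdapted A B) : 4 • (B + 2 • A) = 4 • B := by
  linear_combination (norm := module) h.eight_A

theorem four_add (h : IsAdapted A B) : 4 • (A + B) ≠ 0 := by
  rw [nsmul_add, Ne, add_eq_zero_iff_eq_neg, neg_eq_self_of_two_nsmul h.two_four_B]
  exact h.ne

theorem neg_left (h : IsAdapted A B) : IsAdapted (-A) B where
  eight_A := by rw [neg_nsmul, h.eight_A, neg_zero]
  eight_B := h.eight_B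
  four_A := by rw [neg_nsmul]; exact neg_ne_zero.mpr h.four_A
  four_B := h.four_B
  ne := by rw [neg_nsmul, neg_eq_self_of_two_nsmul h.two_four_A]; exact h.ne
  x_four_B := h.x_four_B

theorem neg_right (h : IsAdapted A B) : IsAdapted A (-B) := by
  have hB : 4 • -B = 4 • B := by rw [neg_nsmul, neg_eq_self_of_two_nsmul h.two_four_B]
  exact ⟨h.eight_A, by rw [neg_nsmul, h.eight_B, neg_zero], h.four_A, hB ▸ h.four_B, hB ▸ h.ne,
    hB ▸ h.x_four_B⟩

theorem five_left (h : IsAdapted A B) : IsAdapted (5 • A) B := by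
  have hA : 4 • 5 • A = 4 • A := by linear_combination (norm := module) (2 : ℤ) • h.eight_A
  exact ⟨by linear_combination (norm := module) (5 : ℤ) • h.eight_A, h.eight_B, hA ▸ h.four_A,
    h.four_B, hA ▸ h.ne, h.x_four_B⟩

theorem five_right (h : IsAdapted A B) : IsAdapted A (5 • B) := by
  have hB : 4 • 5 • B = 4 • B := by linear_combination (norm := module) (2 : ℤ) • h.eight_B
  exact ⟨h.eight_A, by linear_combination (norm := module) (5 : ℤ) • h.eight_B, h.four_A,
    hB ▸ h.four_B, hB ▸ h.ne, hB ▸ h.x_four_B⟩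

theorem add_left (h : IsAdapted A B) : IsAdapted (A + B) B where
  eight_A := by rw [nsmul_add, h.eight_A, h.eight_B, add_zero]
  eight_B := h.eight_B
  four_A := h.four_add
  four_B := h.four_B
  ne := by rw [nsmul_add, Ne, add_eq_right]; exact h.four_A
  x_four_B := h.x_four_B

theorem add_two_right (h : IsAdapted A B) : IsAdapted A (B + 2 • A) := by
  have hB := h.four_add_two'
  exact ⟨h.eight_A, by linear_combination (norm := module) h.eight_B + (2 : ℤ) • h.eight_A,
    h.four_A, hB.symm ▸ h.four_B, hB.symm ▸ h.ne, hB.symm ▸ h.x_four_B⟩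

/-! ### Relations between the quantities entering `sqrtTwo A B` -/

theorem rootDouble_zero_sq (h : IsAdapted A B) {Q : EC} (hQ : 2 • Q ≠ 0) :
    rootDouble 0 Q ^ 2 = xCoord (2 • Q) := by
  have := rootDouble_sq hQ h.two_four_B
  rwa [h.x_four_B, sub_zero] at this

theorem two_A (h : IsAdapted A B) : 2 • A ≠ 0 := two_nsmul_ne_of_four h.four_A

theorem two_B (h : IsAdapted A B) : 2 • B ≠ 0 := two_nsmul_ne_of_four h.four_B

theorem two_two_A (h : IsAdapted A B) : 2 • 2 • A ≠ 0 := four_nsmul_eq A ▸ h.four_A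

theorem two_two_B (h : IsAdapted A B) : 2 • 2 • B ≠ 0 := four_nsmul_eq B ▸ h.four_B

theorem two_add_two (h : IsAdapted A B) : 2 • (A + 2 • B) ≠ 0 :=
  two_nsmul_ne_of_four (h.four_add_two.symm ▸ h.four_A)

theorem x_four_A_ne (h : IsAdapted A B) : xCoord (4 • A) ≠ 0 := by
  rw [← h.x_four_B]
  exact xCoord_ne_of_twoTorsion h.two_four_B h.four_B h.four_A h.ne

theorem x_four_A_root (h : IsAdapted A B) :
    4 * xCoord (4 • A) ^ 2 + 5 * xCoord (4 • A) - 8 = (0 : ℂ) := by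
  apply mul_left_cancel₀ h.x_four_A_ne
  linear_combination xCoord_twoTorsion h.two_four_A

theorem x_four_A_add (h : IsAdapted A B) :
    xCoord (4 • A) + xCoord (4 • (A + B)) = (-5 / 4 : ℂ) := by
  obtain ⟨l, hl, hx, -⟩ := coords_add h.four_A h.four_B
    (xCoord_ne_of_twoTorsion h.two_four_B h.four_B h.four_A h.ne)
  rw [eta_eq_zero_iff.mpr h.two_four_A, eta_eq_zero_iff.mpr h.two_four_B, h.x_four_B, sub_zero,
    sub_zero, mul_eq_zero] at hl
  rw [nsmul_add, hx, hl.resolve_right h.x_four_A_ne, h.x_four_B]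
  ring

theorem x_two_B_sq (h : IsAdapted A B) : xCoord (2 • B) ^ 2 = (-2 : ℂ) := by
  have := xCoord_half (four_nsmul_eq B).symm h.two_four_B h.four_B
  rw [h.x_four_B] at this
  linear_combination this

theorem x_two_A_sq (h : IsAdapted A B) :
    xCoord (2 • A) ^ 2 = (2 * xCoord (4 • A) * xCoord (2 • A) + 2 : ℂ) := by
  have := xCoord_half (four_nsmul_eq A).symm h.two_four_A h.four_A
  linear_combination this + h.x_four_A_root / 2

theorem x_two_B_ne (h : IsAdapted A B) : xCoord (2 • B) ≠ xCoord (4 • A) :=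
  xCoord_ne_of_twoTorsion h.two_four_A h.four_A h.two_B
    (ne_of_two_nsmul_ne h.two_two_B h.two_four_A)

/-- The case `R = 2B`, `T = (0, 0)` of `rootDouble_mul_add_half`. -/
theorem mul_shift (h : IsAdapted A B) :
    rootDouble 0 A * rootDouble 0 (A + 2 • B) = -xCoord (2 • B) := by
  have := rootDouble_mul_add_half (four_nsmul_eq B).symm h.two_four_B h.four_B h.two_A
    h.two_add_two
  rwa [h.x_four_B, zero_sub] at this

theorem root_A_ne (h : IsAdapted A B) : rootDouble 0 A ≠ 0 := by
  rw [← pow_ne_zero_iff two_ne_zero, h.rootDouble_zero_sq h.two_A]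
  exact xCoord_ne_zero h.two_two_A

theorem root_two_A_sq (h : IsAdapted A B) :
    rootDouble 0 (2 • A : EC) ^ 2 = xCoord (4 • A : EC) := by
  rw [h.rootDouble_zero_sq h.two_two_A, ← four_nsmul_eq]

theorem root_two_A_ne (h : IsAdapted A B) : rootDouble 0 (2 • A : EC) ≠ 0 := by
  rw [← pow_ne_zero_iff two_ne_zero, h.root_two_A_sq]
  exact h.x_four_A_ne

theorem root_B_sq (h : IsAdapted A B) :
    rootDouble (xCoord (4 • A)) B ^ 2 = xCoord (2 • B) - xCoord (4 • A) :=
  rootDouble_sq h.two_B h.two_four_A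

theorem root_B_ne (h : IsAdapted A B) : rootDouble (xCoord (4 • A)) B ≠ 0 := by
  rw [← pow_ne_zero_iff two_ne_zero, h.root_B_sq]
  exact sub_ne_zero.mpr h.x_two_B_ne

theorem root_two_B_sq (h : IsAdapted A B) :
    rootDouble (xCoord (4 • A : EC)) (2 • B : EC) ^ 2 = -xCoord (4 • A : EC) := by
  rw [rootDouble_sq h.two_two_B h.two_four_A, ← four_nsmul_eq, h.x_four_B, zero_sub]

theorem sqrtTwo_sq (h : IsAdapted A B) : sqrtTwo A B ^ 2 = 2 := by
  have huv := h.mul_shift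
  have hu := h.rootDouble_zero_sq h.two_A
  have hu0 := h.root_A_ne
  have hs := h.x_two_B_sq
  have hx := h.x_two_A_sq
  have hw : (rootDouble 0 A + rootDouble 0 (A + 2 • B)) ^ 2 =
      2 * (xCoord (4 • A) - xCoord (2 • B)) := by
    apply mul_left_cancel₀ (pow_ne_zero 2 hu0)
    rw [← hu] at hx
    generalize rootDouble 0 A = u at *
    generalize rootDouble 0 (A + 2 • B) = v at *
    generalize xCoord (2 • B) = s at *
    linear_combination hx + hs + (2 * u ^ 2 + u * v - s) * huv
  rw [sqrtTwo, div_pow, mul_pow, mul_pow, hw, h.root_two_B_sq, h.root_B_sq, h.root_two_A_sq,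
    div_eq_iff (mul_ne_zero (sub_ne_zero.mpr h.x_two_B_ne) h.x_four_A_ne)]
  ring

/-! ### Elementary changes of basis -/

theorem sqrtTwo_neg_right (h : IsAdapted A B) : sqrtTwo A (-B) = sqrtTwo A B := by
  have h1 : A + 2 • -B = A + 2 • B + 4 • B := by
    linear_combination (norm := module) -h.eight_B
  have h2 := rootDouble_add_self h.two_add_two h.two_four_B h.four_B
  rw [h.x_four_B] at h2
  rw [sqrtTwo, h1, h2, neg_nsmul, rootDouble_neg, rootDouble_neg, sqrtTwo, mul_neg, neg_mul,
    neg_div_neg_eq]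

theorem sqrtTwo_neg_left (h : IsAdapted A B) : sqrtTwo (-A) B = sqrtTwo A B := by
  have h1 : -A + 2 • B = -(A + 2 • B + 4 • B) := by
    linear_combination (norm := module) h.eight_B
  have h2 := rootDouble_add_self h.two_add_two h.two_four_B h.four_B
  rw [h.x_four_B] at h2
  rw [sqrtTwo, h1, rootDouble_neg, rootDouble_neg, h2, neg_nsmul, neg_nsmul, rootDouble_neg,
    xCoord_neg, sqrtTwo, mul_neg, ← neg_add, neg_mul, neg_div_neg_eq]

theorem sqrtTwo_five_right (h : IsAdapted A B) : sqrtTwo A (5 • B) = -sqrtTwo A B := by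
  have h1 : 2 • 5 • B = 2 • B := by linear_combination (norm := module) h.eight_B
  have h2 : 5 • B = B + 4 • B := by module
  rw [sqrtTwo, h1, h2, rootDouble_add_of_ne h.two_B h.two_four_A h.four_A h.two_four_B h.four_B
    h.ne.symm, neg_mul, div_neg, sqrtTwo]

theorem root_add_four (h : IsAdapted A B) {Q : EC} (hQ : 2 • Q ≠ 0) :
    rootDouble 0 (Q + 4 • A) = -rootDouble 0 Q := by
  have := rootDouble_add_of_ne hQ h.two_four_B h.four_B h.two_four_A h.four_A h.ne
  rwa [h.x_four_B] at this

theorem sqrtTwo_five_left (h : IsAdapted A B) : sqrtTwo (5 • A) B = -sqrtTwo A B := by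
  have h1 : 2 • 5 • A = 2 • A := by linear_combination (norm := module) h.eight_A
  have h2 : 4 • 5 • A = 4 • A := by
    linear_combination (norm := module) (2 : ℤ) • h.eight_A
  have h3 : 5 • A = A + 4 • A := by module
  have h4 : 5 • A + 2 • B = A + 2 • B + 4 • A := by module
  rw [sqrtTwo, h1, h2, h4, h3, h.root_add_four h.two_A, h.root_add_four h.two_add_two, ← neg_add,
    neg_mul, neg_div, sqrtTwo]

theorem sqrtTwo_add_two_right (h : IsAdapted A B) : sqrtTwo A (B + 2 • A) = sqrtTwo A B := by
  have h1 : A + 2 • (B + 2 • A) = A + 2 • B + 4 • A := by module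
  have h2 : 2 • (B + 2 • A) = 2 • B + 4 • A := by module
  have h3 := rootDouble_mul_add_half (four_nsmul_eq A).symm h.two_four_A h.four_A h.two_B
    (two_nsmul_ne_of_four (h.four_add_two'.symm ▸ h.four_B))
  have h4 := h.add_two_right.root_B_ne
  have hB0 := h.root_B_ne
  have hB := h.root_B_sq
  have hA0 := h.root_two_A_ne
  have huv := h.mul_shift
  have hu := h.rootDouble_zero_sq h.two_A
  have hu0 := h.root_A_ne
  have hs := h.x_two_B_sq
  have hx := h.x_two_A_sq
  rw [sqrtTwo, h1, h2, h.root_add_four h.two_add_two,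
    rootDouble_add_self h.two_two_B h.two_four_A h.four_A, sqrtTwo,
    div_eq_div_iff (mul_ne_zero h4 hA0) (mul_ne_zero hB0 hA0)]
  rw [← hu] at hx h3
  generalize rootDouble (xCoord (4 • A)) (B + 2 • A) = z' at *
  generalize rootDouble (xCoord (4 • A)) (2 • B) = g at *
  generalize rootDouble (xCoord (4 • A)) B = z at *
  generalize rootDouble 0 (2 • A : EC) = p at *
  generalize rootDouble 0 A = u at *
  generalize rootDouble 0 (A + 2 • B) = v at *
  generalize xCoord (2 • B) = s at *
  generalize xCoord (4 • A) = e at *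
  have key : (u - v) * z = (u + v) * z' := by
    apply mul_left_cancel₀ hB0
    have hv : u ^ 2 + v ^ 2 = 2 * e := by
      apply mul_left_cancel₀ (pow_ne_zero 2 hu0)
      linear_combination hx + hs + (u * v - s) * huv
    linear_combination (u - v) * hB - (u + v) * h3 + (u - v) * huv + u * hv
  linear_combination g * p * key

/-- As both sides are square roots of `2`, it suffices that their product is `2`; the sign
of this product is determined by `rootDouble_mul_mul_add`. -/
theorem sqrtTwo_add_left (h : IsAdapted A B) : sqrtTwo (A + B) B = sqrtTwo A B := by
  have h' := h.add_left
  have hAB : 2 • (A + B) = 2 • A + 2 • B := nsmul_add ..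
  suffices hmul : sqrtTwo A B * sqrtTwo (A + B) B = 2 by
    have hne : sqrtTwo A B ≠ 0 := by
      intro h0
      simp [h0] at hmul
    apply mul_left_cancel₀ hne
    rw [hmul, ← sq, h.sqrtTwo_sq]
  have hpp := rootDouble_mul_add_half (four_nsmul_eq B).symm h.two_four_B h.four_B h.two_two_A
    (by rw [← hAB]; exact h'.two_two_A)
  rw [← hAB, h.x_four_B, zero_sub] at hpp
  have hsum := h.x_four_A_add
  have he0 := h.x_four_A_ne
  have hroot := h.x_four_A_root
  have hprod : xCoord (4 • A) * xCoord (4 • (A + B)) = (-2 : ℂ) := by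
    linear_combination -hroot / 4 + xCoord (4 • A) * hsum
  have hzz := rootDouble_mul_mul h.two_B hsum hprod
  have hline := rootDouble_mul_mul_add h.two_A h.two_B (two_nsmul_ne_of_four h.four_add)
    (by rintro rfl; exact h.ne rfl)
  have hxs : xCoord (2 • A) ≠ xCoord (2 • B) := fun h0 =>
    (eq_or_eq_neg h.two_A h.two_B h0).elim
      (fun h1 => h.ne (by rw [four_nsmul_eq, four_nsmul_eq, h1]))
      (fun h1 => h.four_add (by rw [four_nsmul_eq, hAB, h1, neg_add_cancel, nsmul_zero]))
  obtain ⟨l, hl, hx', -⟩ := coords_add h.two_A h.two_B hxs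
  have ht0 := eta_ne_zero h.two_two_B
  have hgg : rootDouble (xCoord (4 • A)) (2 • B) * rootDouble (xCoord (4 • (A + B))) (2 • B) =
      xCoord (2 • B) := by
    have hs := h.x_two_B_sq
    have ht := eta_sq (Q := 2 • B)
    rw [rootDouble, rootDouble, div_mul_div_comm, div_eq_iff (mul_ne_zero ht0 ht0)]
    generalize eta (2 • B) = t at *
    generalize xCoord (2 • B) = s at *
    generalize xCoord (4 • A) = e at *
    generalize xCoord (4 • (A + B)) = e' at *
    clear hl hx' hxs hline hpp hzz
    grind
  have huv := h.mul_shift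
  have huv' := h'.mul_shift
  have hu := h.rootDouble_zero_sq h.two_A
  have hu' := h'.rootDouble_zero_sq h'.two_A
  have hw := h.rootDouble_zero_sq h.two_B
  have hs := h.x_two_B_sq
  have hy := eta_sq (Q := 2 • A)
  have ht := eta_sq (Q := 2 • B)
  have hz0 := h.root_B_ne
  have hz0' := h'.root_B_ne
  have hp0 := h.root_two_A_ne
  have hp0' := h'.root_two_A_ne
  have hu0 := h.root_A_ne
  have hu0' := h'.root_A_ne
  rw [hAB, hx'] at hu'
  rw [sqrtTwo, sqrtTwo]
  generalize rootDouble (xCoord (4 • A)) (2 • B) = g at *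
  generalize rootDouble (xCoord (4 • (A + B))) (2 • B) = g' at *
  generalize rootDouble (xCoord (4 • A)) B = z at *
  generalize rootDouble (xCoord (4 • (A + B))) B = z' at *
  generalize rootDouble 0 (2 • A : EC) = p at *
  generalize rootDouble 0 (2 • (A + B) : EC) = p' at *
  generalize rootDouble 0 A = u at *
  generalize rootDouble 0 (A + B) = u' at *
  generalize rootDouble 0 (A + 2 • B) = v at *
  generalize rootDouble 0 (A + B + 2 • B) = v' at *
  generalize rootDouble 0 B = w at *
  generalize eta (2 • A) = y at *
  generalize eta (2 • B) = t at *
  generalize xCoord (2 • A) = x at *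
  generalize xCoord (2 • B) = s at *
  have hd : x - s ≠ 0 := sub_ne_zero.mpr hxs
  have hs0 : s ≠ 0 := by rintro rfl; norm_num at hs
  have hw0 : w ≠ 0 := by rintro rfl; exact hs0 (by rw [← hw]; ring)
  -- multiply by `u u' w` and evaluate with the addition law
  have key : (u + v) * (u' + v') * w = -t := by
    apply mul_left_cancel₀ (mul_ne_zero (mul_ne_zero (mul_ne_zero hu0 hw0) hu0') hd)
    have e1 : u * (u + v) = x - s := by linear_combination hu + huv
    have e2 : u' * (u' + v') = (l ^ 2 - 5) / 4 - x - 2 * s := by linear_combination hu' + huv'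
    have e3 : (x - s) * s * ((l ^ 2 - 5) / 4 - x - 2 * s) * (x - s) =
        -t * (y * s - t * x) / 2 := by
      have hl2 : (l * (x - s)) ^ 2 = (y - t) ^ 2 := by rw [hl]
      have e4 : s * (y ^ 2 + t ^ 2) - s * (5 + 4 * x + 8 * s) * (x - s) ^ 2 -
          2 * t ^ 2 * x = 0 := by
        rw [hy, ht]
        linear_combination (4 * s * x - 4 * s ^ 2) * hs
      linear_combination s / 4 * hl2 + e4 / 4
    linear_combination e3 + t / 2 * hline + (u' * (u' + v') * w ^ 2 * (x - s)) * e1 +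
      ((x - s) ^ 2 * w ^ 2) * e2 + (x - s) ^ 2 * ((l ^ 2 - 5) / 4 - x - 2 * s) * hw
  rw [div_mul_div_comm, div_eq_iff (mul_ne_zero (mul_ne_zero hz0 hp0) (mul_ne_zero hz0' hp0'))]
  apply mul_left_cancel₀ hw0
  linear_combination g * g' * key - t * hgg - 2 * w * z * z' * hpp + s * hzz

end IsAdapted

/-! ### Change of basis and the character of conductor `8` -/

namespace IsAdapted

variable {A B : EC}

theorem add_nsmul_left (h : IsAdapted A B) (n : ℕ) :
    IsAdapted (A + n • B) B ∧ sqrtTwo (A + n • B) B = sqrtTwo A B := by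
  induction n with
  | zero => rw [zero_nsmul, add_zero]; exact ⟨h, rfl⟩
  | succ n ih =>
    rw [succ_nsmul, ← add_assoc]
    exact ⟨ih.1.add_left, ih.1.sqrtTwo_add_left.trans ih.2⟩

theorem add_nsmul_right (h : IsAdapted A B) (n : ℕ) :
    IsAdapted A (B + n • 2 • A) ∧ sqrtTwo A (B + n • 2 • A) = sqrtTwo A B := by
  induction n with
  | zero => rw [zero_nsmul, add_zero]; exact ⟨h, rfl⟩
  | succ n ih =>
    rw [succ_nsmul, ← add_assoc]
    exact ⟨ih.1.add_two_right, ih.1.sqrtTwo_add_two_right.trans ih.2⟩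

theorem nsmul_mod_eight {Q : EC} (hQ : 8 • Q = 0) (n : ℕ) : n • Q = (n % 8) • Q := by
  conv_lhs => rw [← Nat.div_add_mod n 8, add_nsmul, mul_nsmul, hQ, nsmul_zero, zero_add]

/-- Modulo `8` the odd multiples are generated by `-1` and `5`, and `χ₈` takes the values `1` and
`-1` there. -/
theorem nsmul_odd_eq {Q : EC} (hQ : 8 • Q = 0) {n : ℕ} (hn : Odd n) :
    (n • Q = Q ∧ ZMod.χ₈ n = 1) ∨ (n • Q = -Q ∧ ZMod.χ₈ n = 1) ∨
      (n • Q = 5 • Q ∧ ZMod.χ₈ n = -1) ∨ (n • Q = -(5 • Q) ∧ ZMod.χ₈ n = -1) := by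
  rw [nsmul_mod_eight hQ, ZMod.χ₈_nat_eq_if_mod_eight]
  have h1 : n % 8 = 1 ∨ n % 8 = 7 ∨ n % 8 = 5 ∨ n % 8 = 3 := by
    obtain ⟨m, rfl⟩ := hn
    omega
  have h2 : n % 2 ≠ 0 := by
    obtain ⟨m, rfl⟩ := hn
    omega
  rcases h1 with h1 | h1 | h1 | h1
  · exact .inl ⟨by rw [h1, one_nsmul], by simp [h1, h2]⟩
  · exact .inr (.inl ⟨by rw [h1]; linear_combination (norm := module) hQ, by simp [h1, h2]⟩)
  · exact .inr (.inr (.inl ⟨by rw [h1], by simp [h1, h2]⟩))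
  · exact .inr (.inr (.inr ⟨by rw [h1]; linear_combination (norm := module) hQ, by simp [h1, h2]⟩))

theorem odd_nsmul_left (h : IsAdapted A B) {n : ℕ} (hn : Odd n) :
    IsAdapted (n • A) B ∧ sqrtTwo (n • A) B = ZMod.χ₈ n * sqrtTwo A B := by
  rcases nsmul_odd_eq h.eight_A hn with ⟨h1, h2⟩ | ⟨h1, h2⟩ | ⟨h1, h2⟩ | ⟨h1, h2⟩ <;> rw [h1, h2]
  · exact ⟨h, by simp⟩
  · exact ⟨h.neg_left, by simp [h.sqrtTwo_neg_left]⟩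
  · exact ⟨h.five_left, by simp [h.sqrtTwo_five_left]⟩
  · exact ⟨h.five_left.neg_left, by simp [h.five_left.sqrtTwo_neg_left, h.sqrtTwo_five_left]⟩

theorem odd_nsmul_right (h : IsAdapted A B) {n : ℕ} (hn : Odd n) :
    IsAdapted A (n • B) ∧ sqrtTwo A (n • B) = ZMod.χ₈ n * sqrtTwo A B := by
  rcases nsmul_odd_eq h.eight_B hn with ⟨h1, h2⟩ | ⟨h1, h2⟩ | ⟨h1, h2⟩ | ⟨h1, h2⟩ <;> rw [h1, h2]
  · exact ⟨h, by simp⟩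
  · exact ⟨h.neg_right, by simp [h.sqrtTwo_neg_right]⟩
  · exact ⟨h.five_right, by simp [h.sqrtTwo_five_right]⟩
  · exact ⟨h.five_right.neg_right, by simp [h.five_right.sqrtTwo_neg_right, h.sqrtTwo_five_right]⟩

/-- A change of basis that fixes `4B = (0, 0)` acts on `sqrtTwo A B` through the quadratic
character of conductor `8` of its determinant. -/
theorem sqrtTwo_basis_change (h : IsAdapted A B) {a b c d : ℕ} (ha : Odd a) (hc : Even c)
    (hd : Odd d) :
    sqrtTwo (a • A + b • B) (c • A + d • B) =
      ZMod.χ₈ ((a : ZMod 8) * d - b * c) * sqrtTwo A B := by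
  obtain ⟨c, rfl⟩ := hc
  obtain ⟨m, hm⟩ : ∃ m, a * a = 8 * m + 1 := by
    obtain ⟨n, rfl⟩ := ha
    obtain ⟨j, hj⟩ := Nat.even_mul_succ_self n
    exact ⟨j, by linear_combination 4 * hj⟩
  -- `n` represents `a (ad - bc)` modulo `8`, that is `(ad - bc) / a`
  obtain ⟨n, hn⟩ : ∃ n, n = a * a * d + 7 * (a * b * (c + c)) := ⟨_, rfl⟩
  have hodd : Odd n := by
    rw [hn]
    exact ((ha.mul ha).mul hd).add_even (((Even.add_self c).mul_left _).mul_left _)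
  -- the moves `A ↦ aA`, `A ↦ A + bB`, `B ↦ nB`, `B ↦ B + 2caA` lead to the new basis
  obtain ⟨h1, e1⟩ := h.odd_nsmul_left ha
  obtain ⟨h2, e2⟩ := h1.add_nsmul_left b
  obtain ⟨h3, e3⟩ := h2.odd_nsmul_right hodd
  have e4 := (h3.add_nsmul_right (c * a)).2
  have hB : n • B + (c * a) • 2 • (a • A + b • B) = (c + c) • A + d • B := by
    have hm' : (a : ℤ) * a = 8 * m + 1 := by exact_mod_cast hm
    have hn' : (n : ℤ) = a * a * d + 7 * (a * b * (c + c)) := by exact_mod_cast hn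
    have hA8 : (8 : ℤ) • A = 0 := by exact_mod_cast h.eight_A
    have hB8 : (8 : ℤ) • B = 0 := by exact_mod_cast h.eight_B
    have e1 : (2 * c * (a * a) : ℤ) • A = (2 * c : ℤ) • A := by
      rw [hm']
      linear_combination (norm := module) (2 * c * m : ℤ) • hA8
    have e2 : (n + 2 * (c * a * b) : ℤ) • B = (d : ℤ) • B := by
      rw [hn', hm']
      linear_combination (norm := module) (m * d + 2 * (a * b * c) : ℤ) • hB8
    linear_combination (norm := module) e1 + e2
  rw [hB] at e4
  rw [e4, e3, e2, e1, ← mul_assoc, ← Int.cast_mul, ← map_mul]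
  congr 3
  have hm8 : (a : ZMod 8) * a = 1 := by
    rw [← Nat.cast_mul, hm, Nat.cast_add, Nat.cast_mul]
    have : ((8 : ℕ) : ZMod 8) = 0 := rfl
    rw [this]
    simp
  have h7 : (7 : ZMod 8) = -1 := rfl
  rw [hn]
  push_cast
  rw [h7]
  linear_combination ((a : ZMod 8) * d - b * (c + c)) * hm8

end IsAdapted

/-! ### The adapted bases and the Galois action -/

theorem two_pow_nsmul_basisE (𝔅 : AdaptedBases) (m j : ℕ) (i : Fin 2) :
    2 ^ j • (𝔅.basisE (m + j) i : EC) = 𝔅.basisE m i := by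
  induction j with
  | zero => rw [pow_zero, one_nsmul]; rfl
  | succ j ih =>
    rw [pow_succ, mul_nsmul']
    exact (congrArg (2 ^ j • ·) (𝔅.two_nsmul_basisE (m + j) i)).trans ih

theorem basisE_one_ne_zero (𝔅 : AdaptedBases) (i : Fin 2) : (𝔅.basisE 1 i : EC) ≠ 0 := by
  have : Nontrivial (ZMod (2 ^ 1)) := inferInstanceAs (Nontrivial (ZMod 2))
  exact fun h => (𝔅.basisE 1).ne_zero i (Subtype.ext h)

theorem basisE_one_ne (𝔅 : AdaptedBases) : (𝔅.basisE 1 0 : EC) ≠ 𝔅.basisE 1 1 := by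
  have : Nontrivial (ZMod (2 ^ 1)) := inferInstanceAs (Nontrivial (ZMod 2))
  exact fun h => absurd ((𝔅.basisE 1).injective (Subtype.ext h)) (by decide)

theorem two_pow_nsmul_basisE_eq_zero (𝔅 : AdaptedBases) (k : ℕ) (i : Fin 2) :
    2 ^ k • (𝔅.basisE k i : EC) = 0 :=
  mem_tors_iff.mp (𝔅.basisE k i).2

theorem two_nsmul_basisE_one (𝔅 : AdaptedBases) (i : Fin 2) : 2 • (𝔅.basisE 1 i : EC) = 0 :=
  two_pow_nsmul_basisE_eq_zero 𝔅 1 i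

/-- `B₁` lies in the kernel of the isogeny, so it is the point `(0, 0)`. -/
theorem xCoord_basisE_one_one (𝔅 : AdaptedBases) : xCoord (𝔅.basisE 1 1 : EC) = 0 := by
  have hD : 2 • (𝔅.basisE' 1 1 : EC') = 0 := AddSubgroup.torsionBy.nsmul_iff.mp (𝔅.basisE' 1 1).2
  have h := 𝔅.isogeny_B 1
  rw [hD] at h
  generalize (𝔅.basisE 1 1 : EC) = Q at h
  rcases Q with _ | ⟨x, y, hxy⟩
  · rfl
  · by_contra hx
    have hx' : x ≠ 0 := hx
    simp only [isogeny, hx', dif_neg, not_false_eq_true] at h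
    exact WeierstrassCurve.Affine.Point.some_ne_zero _ h

theorem isAdapted_basisE (𝔅 : AdaptedBases) : IsAdapted (𝔅.basisE 3 0) (𝔅.basisE 3 1) := by
  have h4 : ∀ i, 4 • (𝔅.basisE 3 i : EC) = 𝔅.basisE 1 i := two_pow_nsmul_basisE 𝔅 1 2
  exact ⟨two_pow_nsmul_basisE_eq_zero 𝔅 3 0, two_pow_nsmul_basisE_eq_zero 𝔅 3 1,
    h4 0 ▸ basisE_one_ne_zero 𝔅 0, h4 1 ▸ basisE_one_ne_zero 𝔅 1,
    h4 0 ▸ h4 1 ▸ basisE_one_ne 𝔅, h4 1 ▸ xCoord_basisE_one_one 𝔅⟩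

section Galois

variable {k : ℕ}

/-- An element `r` of `K_k` with `r² = 2` detects the action of `σ` on `√2`. -/
theorem sqrt_two_fixed_iff (r : K k) (hr : (r : ℂ) ^ 2 = 2) (σ : K k ≃ₐ[ℚ] K k) :
    ∃ h2 : ((√2 : ℝ) : ℂ) ∈ K k,
      (σ ⟨((√2 : ℝ) : ℂ), h2⟩ = ⟨((√2 : ℝ) : ℂ), h2⟩ ↔ (σ r : ℂ) = r) := by
  have hs : ((√2 : ℝ) : ℂ) ^ 2 = 2 := by
    rw [← Complex.ofReal_pow, Real.sq_sqrt (by norm_num)]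
    norm_num
  rcases sq_eq_sq_iff_eq_or_eq_neg.mp (hs.trans hr.symm) with h | h
  · have h2 : ((√2 : ℝ) : ℂ) ∈ K k := h ▸ r.2
    refine ⟨h2, ?_⟩
    obtain rfl : r = ⟨_, h2⟩ := Subtype.ext h.symm
    exact Subtype.ext_iff
  · have h2 : ((√2 : ℝ) : ℂ) ∈ K k := h ▸ neg_mem r.2
    refine ⟨h2, ?_⟩
    obtain rfl : r = -⟨_, h2⟩ := Subtype.ext (by rw [← neg_eq_iff_eq_neg] at h; exact h.symm)
    rw [map_neg, ← Subtype.ext_iff, neg_inj]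

theorem exists_incl_eq_of_tors {β : EC} (hβ : 2 ^ k • β = P) (T : tors EC (2 ^ k)) :
    ∃ X, incl k X = T :=
  tors_mem_range hβ T.2

theorem incl_galPoint_eq_galTors {β : EC} (hβ : 2 ^ k • β = P) (σ : K k ≃ₐ[ℚ] K k)
    {T : tors EC (2 ^ k)} {X : (E⁄(K k)).Point} (hX : incl k X = T) :
    incl k (galPoint σ X) = galTors σ hβ T := by
  obtain ⟨T, hT⟩ := T
  subst hX
  exact (galAct_incl σ X _).symm

theorem coe_zmod_smul (c : ZMod (2 ^ k)) (T : tors EC (2 ^ k)) :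
    ((c • T : tors EC (2 ^ k)) : EC) = c.val • (T : EC) := by
  have : NeZero (2 ^ k) := ⟨by positivity⟩
  conv_lhs => rw [← ZMod.natCast_zmod_val c, Nat.cast_smul_eq_nsmul]
  rfl

theorem incl_galPoint_basisE (𝔅 : AdaptedBases) {β : EC} (hβ : 2 ^ k • β = P)
    (σ : K k ≃ₐ[ℚ] K k) (i : Fin 2) {X : (E⁄(K k)).Point}
    (hX : incl k X = 𝔅.basisE k i) :
    incl k (galPoint σ X) = (tauMatrix 𝔅 hβ σ i 0).val • (𝔅.basisE k 0 : EC) +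
      (tauMatrix 𝔅 hβ σ i 1).val • (𝔅.basisE k 1 : EC) := by
  rw [incl_galPoint_eq_galTors hβ σ hX, ← (𝔅.basisE k).sum_repr (galTors σ hβ (𝔅.basisE k i)),
    Fin.sum_univ_two, AddSubgroup.coe_add, coe_zmod_smul, coe_zmod_smul]
  rfl

theorem incl_galPoint_eq_add (𝔅 : AdaptedBases) {β : EC} (hβ : 2 ^ k • β = P)
    (σ : K k ≃ₐ[ℚ] K k) {Y : (E⁄(K k)).Point} (hY : incl k Y = β) :
    incl k (galPoint σ Y) = β + ((rho 𝔅 hβ σ).v 0).val • (𝔅.basisE k 0 : EC) +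
      ((rho 𝔅 hβ σ).v 1).val • (𝔅.basisE k 1 : EC) := by
  have h1 : incl k (galPoint σ Y) = β + kummer hβ σ := by
    subst hY
    rw [← galAct_incl σ Y ⟨Y, rfl⟩]
    simp [kummer]
  rw [h1, ← (𝔅.basisE k).sum_repr (kummer hβ σ), Fin.sum_univ_two, AddSubgroup.coe_add,
    coe_zmod_smul, coe_zmod_smul, ← add_assoc]
  rfl

theorem xCoord_incl (X : (E⁄(K k)).Point) : xCoord (incl k X) = xCoord X :=
  xCoord_map (K k).val X

theorem rootDouble_incl (X : (E⁄(K k)).Point) :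
    rootDouble 0 (incl k X) = (rootDouble 0 X : K k) := by
  have := rootDouble_map (K k).val 0 X
  rwa [map_zero] at this

theorem sqrtTwo_incl (X Y : (E⁄(K k)).Point) :
    sqrtTwo (incl k X) (incl k Y) = (sqrtTwo X Y : K k) :=
  sqrtTwo_map (K k).val X Y

theorem xCoord_galPoint (σ : K k ≃ₐ[ℚ] K k) (X : (E⁄(K k)).Point) :
    xCoord (galPoint σ X) = σ (xCoord X) :=
  xCoord_map (σ : K k →ₐ[ℚ] K k) X

theorem rootDouble_galPoint (σ : K k ≃ₐ[ℚ] K k) (X : (E⁄(K k)).Point) :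
    rootDouble 0 (galPoint σ X) = σ (rootDouble 0 X) := by
  have := rootDouble_map (σ : K k →ₐ[ℚ] K k) 0 X
  rwa [map_zero] at this

theorem sqrtTwo_galPoint (σ : K k ≃ₐ[ℚ] K k) (X Y : (E⁄(K k)).Point) :
    sqrtTwo (galPoint σ X) (galPoint σ Y) = σ (sqrtTwo X Y) :=
  sqrtTwo_map (σ : K k →ₐ[ℚ] K k) X Y

end Galois

/-! ### Two square roots of two in `K_k` -/

theorem nsmul_even_eq_zero {T : EC} (hT : 2 • T = 0) {n : ℕ} (hn : Even n) : n • T = 0 := by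
  obtain ⟨m, rfl⟩ := hn
  rw [← two_mul, mul_nsmul, hT, nsmul_zero]

theorem nsmul_odd_eq_self {T : EC} (hT : 2 • T = 0) {n : ℕ} (hn : Odd n) : n • T = T := by
  obtain ⟨m, rfl⟩ := hn
  rw [add_nsmul, one_nsmul, mul_nsmul, hT, nsmul_zero, zero_add]

namespace IsAdapted

variable {A B : EC}

/-- The second row of a matrix fixing `4B` is `(0, 1)` modulo `2`. -/
theorem even_and_odd_of_fixes (h : IsAdapted A B) {c d : ℕ}
    (hcd : 4 • (c • A + d • B) = 4 • B) : Even c ∧ Odd d := by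
  rw [nsmul_add, nsmul_left_comm, nsmul_left_comm B d 4] at hcd
  rcases Nat.even_or_odd c with hc | hc <;> rcases Nat.even_or_odd d with hd | hd
  · rw [nsmul_even_eq_zero h.two_four_A hc, nsmul_even_eq_zero h.two_four_B hd, add_zero] at hcd
    exact absurd hcd.symm h.four_B
  · exact ⟨hc, hd⟩
  · rw [nsmul_odd_eq_self h.two_four_A hc, nsmul_even_eq_zero h.two_four_B hd, add_zero] at hcd
    exact absurd hcd h.ne
  · rw [nsmul_odd_eq_self h.two_four_A hc, nsmul_odd_eq_self h.two_four_B hd, add_eq_right] at hcd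
    exact absurd hcd h.four_A

theorem odd_of_ne (h : IsAdapted A B) {a b : ℕ} (h0 : 4 • (a • A + b • B) ≠ 0)
    (h1 : 4 • (a • A + b • B) ≠ 4 • B) : Odd a := by
  rw [nsmul_add, nsmul_left_comm, nsmul_left_comm B b 4] at h0 h1
  by_contra ha
  rw [nsmul_even_eq_zero h.two_four_A (Nat.not_odd_iff_even.mp ha), zero_add] at h0 h1
  rcases Nat.even_or_odd b with hb | hb
  · exact h0 (nsmul_even_eq_zero h.two_four_B hb)
  · exact h1 (nsmul_odd_eq_self h.two_four_B hb)

end IsAdapted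

section Galois

variable {k : ℕ}

theorem incl_galPoint_ne_zero (σ : K k ≃ₐ[ℚ] K k) {X : (E⁄(K k)).Point} (hX : incl k X ≠ 0) :
    incl k (galPoint σ X) ≠ 0 := by
  rintro h
  apply hX
  have h1 : galPoint σ X = 0 := incl_injective k (h.trans (map_zero _).symm)
  have h2 : X = 0 := WeierstrassCurve.Affine.Point.map_injective (σ : K k →ₐ[ℚ] K k)
    (h1.trans (map_zero (galPoint σ)).symm)
  rw [h2, map_zero]

theorem incl_galPoint_ne_of_ne (σ : K k ≃ₐ[ℚ] K k) {X Y : (E⁄(K k)).Point}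
    (h : incl k X ≠ incl k Y) : incl k (galPoint σ X) ≠ incl k (galPoint σ Y) := by
  have := incl_galPoint_ne_zero σ (X := X - Y) (by rwa [map_sub, Ne, sub_eq_zero])
  rwa [map_sub, map_sub, Ne, sub_eq_zero] at this

/-- The rational point `(0, 0)` is fixed by the Galois action. -/
theorem incl_galPoint_of_xCoord_eq_zero (σ : K k ≃ₐ[ℚ] K k) {X : (E⁄(K k)).Point}
    (h0 : incl k X ≠ 0) (hx : xCoord (incl k X) = 0) : incl k (galPoint σ X) = incl k X := by
  have h2 : 2 • incl k X = 0 := by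
    rw [← eta_eq_zero_iff, ← sq_eq_zero_iff, eta_sq, hx]
    ring
  by_contra hne
  apply xCoord_ne_of_twoTorsion h2 h0 (incl_galPoint_ne_zero σ h0) hne
  rw [xCoord_incl, ZeroMemClass.coe_eq_zero] at hx
  rw [xCoord_incl, xCoord_incl, xCoord_galPoint, hx, map_zero]

/-- The Galois action on the value of `sqrtTwo` at the `8`-torsion basis is given by the quadratic character of conductor `8` of the
determinant of the action on `E[8]`. -/
theorem exists_sqrtTwo_det (𝔅 : AdaptedBases) (hk : 3 ≤ k) {β : EC} (hβ : 2 ^ k • β = P)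
    (σ : K k ≃ₐ[ℚ] K k) : ∃ r : K k, (r : ℂ) ^ 2 = 2 ∧
      ((σ r : ℂ) = r ↔ ((tauMatrix 𝔅 hβ σ).det.val ≡ 1 [MOD 8] ∨
        (tauMatrix 𝔅 hβ σ).det.val ≡ 7 [MOD 8])) := by
  have : NeZero (2 ^ k) := ⟨by positivity⟩
  obtain ⟨j, rfl⟩ := Nat.exists_eq_add_of_le hk
  obtain ⟨X, hX⟩ := exists_incl_eq_of_tors hβ (𝔅.basisE (3 + j) 0)
  obtain ⟨Y, hY⟩ := exists_incl_eq_of_tors hβ (𝔅.basisE (3 + j) 1)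
  have hσX := incl_galPoint_basisE 𝔅 hβ σ 0 hX
  have hσY := incl_galPoint_basisE 𝔅 hβ σ 1 hY
  have hdet : (((tauMatrix 𝔅 hβ σ).det.val : ℕ) : ZMod 8) =
      ((tauMatrix 𝔅 hβ σ 0 0).val : ZMod 8) * (tauMatrix 𝔅 hβ σ 1 1).val -
        (tauMatrix 𝔅 hβ σ 0 1).val * (tauMatrix 𝔅 hβ σ 1 0).val := by
    have h8 : 8 ∣ 2 ^ (3 + j) := ⟨2 ^ j, by rw [pow_add]; norm_num⟩
    simp only [ZMod.natCast_val]
    rw [Matrix.det_fin_two, ZMod.cast_sub h8, ZMod.cast_mul h8, ZMod.cast_mul h8]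
  -- pass from `E[2 ^ k]` to `E[8]`
  have hX3 : incl _ (2 ^ j • X) = 𝔅.basisE 3 0 := by
    rw [map_nsmul, hX, two_pow_nsmul_basisE]
  have hY3 : incl _ (2 ^ j • Y) = 𝔅.basisE 3 1 := by
    rw [map_nsmul, hY, two_pow_nsmul_basisE]
  have hσX3 : incl _ (galPoint σ (2 ^ j • X)) = (tauMatrix 𝔅 hβ σ 0 0).val •
      (𝔅.basisE 3 0 : EC) + (tauMatrix 𝔅 hβ σ 0 1).val • (𝔅.basisE 3 1 : EC) := by
    rw [map_nsmul, map_nsmul, hσX, nsmul_add, nsmul_left_comm, two_pow_nsmul_basisE,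
      nsmul_left_comm, two_pow_nsmul_basisE]
  have hσY3 : incl _ (galPoint σ (2 ^ j • Y)) = (tauMatrix 𝔅 hβ σ 1 0).val •
      (𝔅.basisE 3 0 : EC) + (tauMatrix 𝔅 hβ σ 1 1).val • (𝔅.basisE 3 1 : EC) := by
    rw [map_nsmul, map_nsmul, hσY, nsmul_add, nsmul_left_comm, two_pow_nsmul_basisE,
      nsmul_left_comm, two_pow_nsmul_basisE]
  generalize 2 ^ j • X = X₃ at hX3 hσX3
  generalize 2 ^ j • Y = Y₃ at hY3 hσY3
  have h := isAdapted_basisE 𝔅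
  rw [← hX3, ← hY3] at h hσX3 hσY3
  have hfix : 4 • incl _ (galPoint σ Y₃) = 4 • incl _ Y₃ := by
    have := incl_galPoint_of_xCoord_eq_zero σ (X := 4 • Y₃) (by rw [map_nsmul]; exact h.four_B)
      (by rw [map_nsmul]; exact h.x_four_B)
    rwa [map_nsmul, map_nsmul, map_nsmul] at this
  obtain ⟨hc, hd⟩ := h.even_and_odd_of_fixes (hσY3 ▸ hfix)
  have ha := h.odd_of_ne (a := (tauMatrix 𝔅 hβ σ 0 0).val) (b := (tauMatrix 𝔅 hβ σ 0 1).val)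
    (by
      rw [← hσX3, ← map_nsmul, ← map_nsmul]
      exact incl_galPoint_ne_zero σ (by rw [map_nsmul]; exact h.four_A))
    (by
      rw [← hσX3, ← hfix, ← map_nsmul, ← map_nsmul, ← map_nsmul, ← map_nsmul]
      exact incl_galPoint_ne_of_ne σ (by rw [map_nsmul, map_nsmul]; exact h.ne))
  have key := h.sqrtTwo_basis_change (b := (tauMatrix 𝔅 hβ σ 0 1).val) ha hc hd
  have hsq := h.sqrtTwo_sq
  rw [← hσX3, ← hσY3, sqrtTwo_incl, sqrtTwo_incl, sqrtTwo_galPoint, ← hdet] at key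
  rw [sqrtTwo_incl] at hsq
  refine ⟨_, hsq, ?_⟩
  have hr0 : ((sqrtTwo X₃ Y₃ : K (3 + j)) : ℂ) ≠ 0 := by
    intro h0
    rw [h0] at hsq
    norm_num at hsq
  -- if the determinant were even, `χ₈` would vanish on it and the conjugate of `√2` would be `0`
  have hodd : (tauMatrix 𝔅 hβ σ).det.val % 2 ≠ 0 := by
    intro h2
    rw [ZMod.χ₈_nat_eq_if_mod_eight, if_pos h2, Int.cast_zero, zero_mul, ZeroMemClass.coe_eq_zero,
      map_eq_zero] at key
    exact hr0 (by rw [key]; rfl)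
  rw [key, mul_eq_right₀ hr0, ZMod.χ₈_nat_eq_if_mod_eight, if_neg hodd]
  unfold Nat.ModEq
  split_ifs with h8
  · simpa using h8
  · simp only [Int.cast_neg, Int.cast_one]
    refine iff_of_false (by norm_num) h8

/-- The point `2 ^ (k - 1) β` is a half of `P`, and `x(P) = 2`, so `rootDouble 0` takes the value
`±√2` there; its sign under `σ` is the parity of `e`. -/
theorem exists_sqrtTwo_kummer (𝔅 : AdaptedBases) (hk : 3 ≤ k) {β : EC} (hβ : 2 ^ k • β = P)
    (σ : K k ≃ₐ[ℚ] K k) : ∃ r : K k, (r : ℂ) ^ 2 = 2 ∧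
      ((σ r : ℂ) = r ↔ ((rho 𝔅 hβ σ).v 0).val ≡ 0 [MOD 2]) := by
  obtain ⟨j, rfl⟩ := Nat.exists_eq_add_of_le (show 1 ≤ k by omega)
  obtain ⟨Y, hY⟩ := mem_range_of_nsmul hβ
  have hσY := incl_galPoint_eq_add 𝔅 hβ σ hY
  have hQ2 : 2 • 2 ^ j • β = P := by rw [← hβ, smul_smul, pow_add, pow_one]
  have hQ : 2 • 2 ^ j • β ≠ 0 := hQ2 ▸ WeierstrassCurve.Affine.Point.some_ne_zero _
  have hY1 : incl _ (2 ^ j • Y) = 2 ^ j • β := by rw [map_nsmul, hY]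
  have hσY1 : incl _ (galPoint σ (2 ^ j • Y)) = 2 ^ j • β +
      ((rho 𝔅 hβ σ).v 0).val • (𝔅.basisE 1 0 : EC) +
      ((rho 𝔅 hβ σ).v 1).val • (𝔅.basisE 1 1 : EC) := by
    rw [map_nsmul, map_nsmul, hσY, nsmul_add, nsmul_add, nsmul_left_comm, two_pow_nsmul_basisE,
      nsmul_left_comm, two_pow_nsmul_basisE]
  generalize 2 ^ j • Y = Y₁ at hY1 hσY1
  generalize 2 ^ j • β = Q at *
  have hA := two_nsmul_basisE_one 𝔅 0
  have hB := two_nsmul_basisE_one 𝔅 1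
  have hA0 := basisE_one_ne_zero 𝔅 0
  have hB0 := basisE_one_ne_zero 𝔅 1
  have hAB := basisE_one_ne 𝔅
  have hxB := xCoord_basisE_one_one 𝔅
  generalize (𝔅.basisE 1 0 : EC) = A at *
  generalize (𝔅.basisE 1 1 : EC) = B at *
  have hsq := rootDouble_sq hQ hB
  rw [hxB, hQ2, sub_zero, show xCoord P = 2 from rfl] at hsq
  have hr0 : rootDouble 0 Q ≠ 0 := by
    intro h0
    rw [h0] at hsq
    norm_num at hsq
  have hadd : ∀ {R : EC} (n : ℕ), 2 • R ≠ 0 → rootDouble 0 (R + n • B) = rootDouble 0 R := by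
    intro R n hR
    rcases Nat.even_or_odd n with hn | hn
    · rw [nsmul_even_eq_zero hB hn, add_zero]
    · have := rootDouble_add_self hR hB hB0
      rwa [hxB, ← nsmul_odd_eq_self hB hn] at this
  refine ⟨rootDouble 0 Y₁, by rw [← rootDouble_incl, hY1, hsq], ?_⟩
  rw [← rootDouble_galPoint, ← rootDouble_incl, ← rootDouble_incl, hσY1, hY1]
  generalize ((rho 𝔅 hβ σ).v 0).val = m
  have hQm : 2 • (Q + m • A) ≠ 0 := by
    rwa [nsmul_add, nsmul_left_comm, hA, nsmul_zero, add_zero]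
  rw [hadd _ hQm, Nat.ModEq, Nat.zero_mod, ← Nat.even_iff]
  rcases Nat.even_or_odd m with hm | hm
  · exact iff_of_true (by rw [nsmul_even_eq_zero hA hm, add_zero]) hm
  · have := rootDouble_add_of_ne hQ hB hB0 hA hA0 hAB
    rw [hxB] at this
    rw [nsmul_odd_eq_self hA hm, this]
    exact iff_of_false (neg_ne_self.mpr hr0) (Nat.not_even_iff_odd.mpr hm)

end Galois
end SomosFive

theorem mainTheorem10 (𝔅 : SomosFive.AdaptedBases) (k : ℕ) (hk : 3 ≤ k)
    (β : SomosFive.EC) (hβ : 2 ^ k • β = SomosFive.P)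
    (σ : SomosFive.K k ≃ₐ[ℚ] SomosFive.K k)
    (e f : ZMod (2 ^ k)) (M : GL (Fin 2) (ZMod (2 ^ k)))
    (hσ : SomosFive.rho 𝔅 hβ σ = ⟨![e, f], M⟩) :
    (e.val ≡ 0 [MOD 2] ↔
      (M.val.det.val ≡ 1 [MOD 8] ∨ M.val.det.val ≡ 7 [MOD 8])) ∧
    ∃ h2 : ((√2 : ℝ) : ℂ) ∈ SomosFive.K k,
      (e.val ≡ 0 [MOD 2] ↔ σ ⟨((√2 : ℝ) : ℂ), h2⟩ = ⟨((√2 : ℝ) : ℂ), h2⟩) ∧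
      ((M.val.det.val ≡ 1 [MOD 8] ∨ M.val.det.val ≡ 7 [MOD 8]) ↔
        σ ⟨((√2 : ℝ) : ℂ), h2⟩ = ⟨((√2 : ℝ) : ℂ), h2⟩) := by
  obtain ⟨r, hr, hdet⟩ := SomosFive.exists_sqrtTwo_det 𝔅 hk hβ σ
  obtain ⟨s, hs, hkum⟩ := SomosFive.exists_sqrtTwo_kummer 𝔅 hk hβ σ
  obtain ⟨h2, hr2⟩ := SomosFive.sqrt_two_fixed_iff r hr σ
  obtain ⟨_, hs2⟩ := SomosFive.sqrt_two_fixed_iff s hs σ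
  have he : (SomosFive.rho 𝔅 hβ σ).v 0 = e := by rw [hσ]; rfl
  have hM : SomosFive.tauMatrix 𝔅 hβ σ = M.val :=
    congrArg (fun g => (SomosFive.AGL2.M g).val) hσ
  rw [he] at hkum
  rw [hM] at hdet
  have h1 := hkum.symm.trans hs2.symm
  have h3 := hdet.symm.trans hr2.symm
  exact ⟨h1.trans h3.symm, h2, h1, h3⟩
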